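/- Let $G$ be a connected complex semisimple group (i.e. a connected complex Lie group whose Lie algebra is semisimple), and let $V = V_0 \boxplus V_1$ be a finite-dimensional complex super vector space with holomorphic representations of $G$ on the even part $V_0$ and on the odd part $V_1$. Let $$V_0 = U_1 \oplus \dots \oplus U_k, \qquad V_1 = W_1 \oplus \dots \oplus W_l$$ be decompositions into irreducible $G$-submodules ($k, l \ge 0$). Let $P(V) = S(V_0) \otimes \bigwedge(V_1)$ be the supersymmetric algebra of $V$. It is the direct sum of its $G$-submodules $$P^{(\mathbf i,\mathbf j)}(V) = S^{i_1}U_1 \otimes \dots \otimes S^{i_k}U_k \otimes \textstyle\bigwedge^{j_1} W_1 \otimes \dots \otimes \bigwedge^{j_l} W_l, \qquad \mathbf i \in \mathbb N^k,\ \mathbf j \in \mathbb N^l.$$ The pair $(G,V)$ is called super MF (super multiplicity-free) if $\dim \operatorname{Hom}_G\bigl(P^{(\mathbf i,\mathbf j)}(V), \Gamma\bigr) \le 1$ for all $(\mathbf i,\mathbf j)$ and all irreducible finite-dimensional holomorphic representations $\Gamma$ of $G$. Let $PD(V) \subseteq \operatorname{End}_{\mathbb C}(P(V))$ be the algebra of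 polynomial coefficient differential operators, i.e. the subalgebra generated by the multiplications with vectors of $V_0$ and of $V_1$, the derivations $\partial_\lambda$ for $\lambda \in V_0^*$, and the odd derivations (contractions) $\partial_\mu$ for $\mu \in V_1^*$. Let $\tilde G = (\mathbb C^*)^{k+l} \times G$ be the saturated group. It acts on $V$ by the given action of $G$, together with the $p$-th copy of $\mathbb C^*$ acting by scalar multiplication on the $p$-th of the submodules $U_1,\dots,U_k,W_1,\dots,W_l$ and trivially on the others. It acts on $P(V)$ by algebra automorphisms, and on $PD(V)$ by conjugation. Let $PD(V)^{\tilde G}$ be the subalgebra of invariants. Then $(G,V)$ is super MF if and only if the algebra $PD(V)^{\tilde G}$ is commutative. -/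

import Mathlib

open scoped TensorProduct Manifold ContDiff

noncomputable section

namespace SuperMF

/-! ### The supersymmetric algebra `P(V) = S(V₀) ⊗ Λ(V₁)` -/

section Algebra

variable (V₀ V₁ : Type*) [AddCommGroup V₀] [Module ℂ V₀] [AddCommGroup V₁] [Module ℂ V₁]

/-- The supersymmetric algebra of the super vector space `V₀ ⊞ V₁`: the symmetric algebra of the
even part tensored with the exterior algebra of the odd part. -/
abbrev SuperSym : Type _ := SymmetricAlgebra ℂ V₀ ⊗[ℂ] ExteriorAlgebra ℂ V₁

variable {V₀ V₁}

/-- The algebra endomorphism of the symmetric algebra induced by a linear endomorphism. -/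
def symMap (f : V₀ →ₗ[ℂ] V₀) : SymmetricAlgebra ℂ V₀ →ₐ[ℂ] SymmetricAlgebra ℂ V₀ :=
  SymmetricAlgebra.lift (SymmetricAlgebra.ι ℂ V₀ ∘ₗ f)

@[simp]
lemma symMap_ι (f : V₀ →ₗ[ℂ] V₀) (v : V₀) :
    symMap f (SymmetricAlgebra.ι ℂ V₀ v) = SymmetricAlgebra.ι ℂ V₀ (f v) := by
  simp [symMap]

/-- The constant coefficient vector field `∂_lam` on the symmetric algebra, first as a linear map:
it is the `ε`-part of the algebra homomorphism `v ↦ v + lam(v) ε` into the dual numbers. -/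
def symDerivAux (lam : Module.Dual ℂ V₀) :
    SymmetricAlgebra ℂ V₀ →ₐ[ℂ] DualNumber (SymmetricAlgebra ℂ V₀) :=
  SymmetricAlgebra.lift
    ((TrivSqZeroExt.inlAlgHom ℂ (SymmetricAlgebra ℂ V₀) (SymmetricAlgebra ℂ V₀)).toLinearMap ∘ₗ
        SymmetricAlgebra.ι ℂ V₀ +
      (TrivSqZeroExt.inrHom (SymmetricAlgebra ℂ V₀) (SymmetricAlgebra ℂ V₀)).restrictScalars ℂ ∘ₗ
        Algebra.linearMap ℂ (SymmetricAlgebra ℂ V₀) ∘ₗ lam)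

lemma symDerivAux_fst (lam : Module.Dual ℂ V₀) (x : SymmetricAlgebra ℂ V₀) :
    (symDerivAux lam x).fst = x := by
  have h : (TrivSqZeroExt.fstHom ℂ (SymmetricAlgebra ℂ V₀) (SymmetricAlgebra ℂ V₀)).comp
      (symDerivAux lam) = AlgHom.id ℂ _ := by
    apply SymmetricAlgebra.algHom_ext
    ext v
    simp [symDerivAux]
  exact congrArg (fun F : SymmetricAlgebra ℂ V₀ →ₐ[ℂ] SymmetricAlgebra ℂ V₀ => F x) h

/-- The partial derivative `∂_lam` on `S(V₀)` in the direction of a linear form `lam`: the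
derivation of the symmetric algebra that extends `lam`. -/
def symDeriv (lam : Module.Dual ℂ V₀) :
    Derivation ℂ (SymmetricAlgebra ℂ V₀) (SymmetricAlgebra ℂ V₀) where
  toLinearMap :=
    (TrivSqZeroExt.sndHom (SymmetricAlgebra ℂ V₀) (SymmetricAlgebra ℂ V₀)).restrictScalars ℂ ∘ₗ
      (symDerivAux lam).toLinearMap
  map_one_eq_zero' := by simp
  leibniz' a b := by
    simp [symDerivAux_fst, mul_comm]

@[simp]
lemma symDeriv_ι (lam : Module.Dual ℂ V₀) (v : V₀) :
    symDeriv lam (SymmetricAlgebra.ι ℂ V₀ v) = algebraMap ℂ _ (lam v) := by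
  change (symDerivAux lam (SymmetricAlgebra.ι ℂ V₀ v)).snd = _
  simp [symDerivAux, Algebra.algebraMap_eq_smul_one]

/-- Multiplication by an even vector. -/
def evenMul (v : V₀) : Module.End ℂ (SuperSym V₀ V₁) :=
  LinearMap.mulLeft ℂ (SymmetricAlgebra.ι ℂ V₀ v ⊗ₜ[ℂ] (1 : ExteriorAlgebra ℂ V₁))

/-- Multiplication by an odd vector. -/
def oddMul (w : V₁) : Module.End ℂ (SuperSym V₀ V₁) :=
  LinearMap.mulLeft ℂ ((1 : SymmetricAlgebra ℂ V₀) ⊗ₜ[ℂ] ExteriorAlgebra.ι ℂ w)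

/-- The derivation of `P(V)` given by a linear form on the even part. -/
def evenDeriv (lam : Module.Dual ℂ V₀) : Module.End ℂ (SuperSym V₀ V₁) :=
  TensorProduct.map (symDeriv lam).toLinearMap LinearMap.id

/-- The superderivation (odd derivation) of `P(V)` given by a linear form on the odd part:
contraction on the exterior factor. No sign appears, since `S(V₀)` is purely even. -/
def oddDeriv (mu : Module.Dual ℂ V₁) : Module.End ℂ (SuperSym V₀ V₁) :=
  TensorProduct.map LinearMap.id
    (CliffordAlgebra.contractLeft (Q := (0 : QuadraticForm ℂ V₁)) mu)

variable (V₀ V₁) in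
/-- The algebra `PD(V)` of differential operators with polynomial coefficients on `P(V)`: the
subalgebra of `End(P(V))` generated by the multiplications with vectors of `V` and the
(super)derivations given by linear forms on `V`. -/
def diffOps : Subalgebra ℂ (Module.End ℂ (SuperSym V₀ V₁)) :=
  Algebra.adjoin ℂ (Set.range evenMul ∪ Set.range oddMul ∪ Set.range evenDeriv ∪
    Set.range oddDeriv)

end Algebra

/-! ### Group actions -/

section Action

variable {H : Type*} [Group H]
variable {V₀ V₁ : Type*} [AddCommGroup V₀] [Module ℂ V₀] [AddCommGroup V₁] [Module ℂ V₁]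

/-- The induced action on the symmetric algebra, by algebra automorphisms. -/
def symRep (ρ : Representation ℂ H V₀) : Representation ℂ H (SymmetricAlgebra ℂ V₀) where
  toFun g := (symMap (ρ g)).toLinearMap
  map_one' := by
    have h : symMap (ρ 1) = AlgHom.id ℂ _ := by
      apply SymmetricAlgebra.algHom_ext
      ext v
      simp
    rw [h]; rfl
  map_mul' a b := by
    have h : symMap (ρ (a * b)) = (symMap (ρ a)).comp (symMap (ρ b)) := by
      apply SymmetricAlgebra.algHom_ext
      ext v
      simp
    rw [h]; rfl

/-- The induced action on the exterior algebra, by algebra automorphisms. -/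
def extRep (ρ : Representation ℂ H V₁) : Representation ℂ H (ExteriorAlgebra ℂ V₁) where
  toFun g := (ExteriorAlgebra.map (ρ g)).toLinearMap
  map_one' := by
    rw [map_one, Module.End.one_eq_id, ExteriorAlgebra.map_id]; rfl
  map_mul' a b := by
    rw [map_mul, Module.End.mul_eq_comp, ← ExteriorAlgebra.map_comp_map]; rfl

/-- The induced action on `P(V) = S(V₀) ⊗ Λ(V₁)`. -/
def superSymRep (ρ₀ : Representation ℂ H V₀) (ρ₁ : Representation ℂ H V₁) :
    Representation ℂ H (SuperSym V₀ V₁) :=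
  (symRep ρ₀).tprod (extRep ρ₁)

/-- The algebra `PD(V)^H` of `H`-invariant differential operators, where `H` acts on `PD(V)` by
conjugation, `(h · D) = h ∘ D ∘ h⁻¹` (see `mem_invDiffOps`). -/
def invDiffOps (ρ₀ : Representation ℂ H V₀) (ρ₁ : Representation ℂ H V₁) :
    Subalgebra ℂ (Module.End ℂ (SuperSym V₀ V₁)) :=
  diffOps V₀ V₁ ⊓ Subalgebra.centralizer ℂ (Set.range (superSymRep ρ₀ ρ₁))

lemma mem_invDiffOps (ρ₀ : Representation ℂ H V₀) (ρ₁ : Representation ℂ H V₁)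
    (D : Module.End ℂ (SuperSym V₀ V₁)) :
    D ∈ invDiffOps ρ₀ ρ₁ ↔
      D ∈ diffOps V₀ V₁ ∧ ∀ h : H, superSymRep ρ₀ ρ₁ h * D * superSymRep ρ₀ ρ₁ h⁻¹ = D := by
  rw [invDiffOps, Algebra.mem_inf, Subalgebra.mem_centralizer_iff]
  refine and_congr_right fun _ => ⟨fun hc h => ?_, ?_⟩
  · rw [hc _ ⟨h, rfl⟩, mul_assoc, ← map_mul, mul_inv_cancel, map_one, mul_one]
  · rintro hc _ ⟨h, rfl⟩
    conv_rhs => rw [← hc h]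
    rw [mul_assoc, ← map_mul, inv_mul_cancel, map_one, mul_one]

end Action

/-! ### The summands `P^(i,j)(V)` and the super multiplicity-free property -/

section Components

variable {V₀ V₁ : Type*} [AddCommGroup V₀] [Module ℂ V₀] [AddCommGroup V₁] [Module ℂ V₁]

/-- The summand `P^(i,j)(V) = S^{i₁}U₁ ⊗ ⋯ ⊗ S^{i_k}U_k ⊗ Λ^{j₁}W₁ ⊗ ⋯ ⊗ Λ^{j_l}W_l` of `P(V)`,
for `V₀ = U₁ ⊕ ⋯ ⊕ U_k` and `V₁ = W₁ ⊕ ⋯ ⊕ W_l`, as a subspace of `P(V)`: the products of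
`i_p` vectors from each `U_p` in `S(V₀)`, tensored with the products of `j_q` vectors from each
`W_q` in `Λ(V₁)`. -/
def component {k l : ℕ} (U : Fin k → Submodule ℂ V₀) (W : Fin l → Submodule ℂ V₁)
    (i : Fin k → ℕ) (j : Fin l → ℕ) : Submodule ℂ (SuperSym V₀ V₁) :=
  Submodule.map₂ (TensorProduct.mk ℂ (SymmetricAlgebra ℂ V₀) (ExteriorAlgebra ℂ V₁))
    (∏ p, (U p).map (SymmetricAlgebra.ι ℂ V₀) ^ i p)
    (List.ofFn fun q => (W q).map (ExteriorAlgebra.ι ℂ) ^ j q).prod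

lemma map_prod_le {A : Type*} [CommRing A] [Algebra ℂ A] (F : A →ₐ[ℂ] A) {k : ℕ}
    (U : Fin k → Submodule ℂ A) (hU : ∀ p, (U p).map F.toLinearMap ≤ U p) (i : Fin k → ℕ) :
    (∏ p, U p ^ i p).map F.toLinearMap ≤ ∏ p, U p ^ i p := by
  have h1 : (∏ p, U p ^ i p).map F.toLinearMap = ∏ p, ((U p).map F.toLinearMap) ^ i p := by
    change Submodule.mapHom F _ = ∏ p, (Submodule.mapHom F (U p)) ^ i p
    rw [map_prod]
    simp only [map_pow]
  rw [h1]
  exact Finset.prod_le_prod' fun p _ => pow_le_pow_left' (hU p) _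

lemma map_list_prod_le {A : Type*} [Ring A] [Algebra ℂ A] (F : A →ₐ[ℂ] A) (L : List (Submodule ℂ A))
    (hL : ∀ N ∈ L, N.map F.toLinearMap ≤ N) : L.prod.map F.toLinearMap ≤ L.prod := by
  induction L with
  | nil =>
    rw [List.prod_nil]
    exact (Submodule.map_one F).le
  | cons N L ih =>
    rw [List.prod_cons, Submodule.map_mul]
    exact mul_le_mul' (hL N (by simp)) (ih fun M hM => hL M (by simp [hM]))

variable {G : Type*} [Group G]

/-- The `G`-submodule `P^(i,j)(V)` of `P(V)`. -/
def componentRep {ρ₀ : Representation ℂ G V₀} {ρ₁ : Representation ℂ G V₁} {k l : ℕ}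
    (U : Fin k → Subrepresentation ρ₀) (W : Fin l → Subrepresentation ρ₁)
    (i : Fin k → ℕ) (j : Fin l → ℕ) : Subrepresentation (superSymRep ρ₀ ρ₁) where
  toSubmodule := component (fun p => (U p).toSubmodule) (fun q => (W q).toSubmodule) i j
  apply_mem_toSubmodule g v hv := by
    have hU : ∀ p, ((U p).toSubmodule.map (SymmetricAlgebra.ι ℂ V₀)).map
        (symMap (ρ₀ g)).toLinearMap ≤ (U p).toSubmodule.map (SymmetricAlgebra.ι ℂ V₀) := by
      rintro p _ ⟨_, ⟨u, hu, rfl⟩, rfl⟩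
      exact ⟨ρ₀ g u, (U p).apply_mem_toSubmodule g hu, by simp⟩
    have hW : ∀ q, ((W q).toSubmodule.map (ExteriorAlgebra.ι ℂ)).map
        (ExteriorAlgebra.map (ρ₁ g)).toLinearMap ≤
          (W q).toSubmodule.map (ExteriorAlgebra.ι ℂ) := by
      rintro q _ ⟨_, ⟨w, hw, rfl⟩, rfl⟩
      exact ⟨ρ₁ g w, (W q).apply_mem_toSubmodule g hw, by simp⟩
    have h0 := map_prod_le (symMap (ρ₀ g)) _ hU i
    have h1 := map_list_prod_le (ExteriorAlgebra.map (ρ₁ g))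
      (List.ofFn fun q => (W q).toSubmodule.map (ExteriorAlgebra.ι ℂ) ^ j q) (by
        intro N hN
        obtain ⟨q, rfl⟩ := (List.mem_ofFn' _ _).mp hN
        rw [Submodule.map_pow]
        exact pow_le_pow_left' (hW q) _)
    unfold component at hv ⊢
    rw [← Submodule.mem_comap]
    refine (Submodule.map₂_le.mpr fun x hx y hy => ?_) hv
    exact Submodule.apply_mem_map₂ _ (h0 ⟨x, hx, rfl⟩) (h1 ⟨y, hy, rfl⟩)

end Components

section Main

variable {d : ℕ} {G : Type*} [Group G] [TopologicalSpace G]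
  [ChartedSpace (EuclideanSpace ℂ (Fin d)) G]

variable (d) in
/-- A finite-dimensional complex representation is holomorphic if all its matrix coefficients are
holomorphic (complex analytic) functions on the complex Lie group `G`. -/
def IsHolomorphic {X : Type*} [AddCommGroup X] [Module ℂ X] (ρ : Representation ℂ G X) : Prop :=
  ∀ (x : X) (φ : Module.Dual ℂ X),
    ContMDiff 𝓘(ℂ, EuclideanSpace ℂ (Fin d)) 𝓘(ℂ, ℂ) ω (fun g : G => φ (ρ g x))

variable {V₀ V₁ : Type*} [AddCommGroup V₀] [Module ℂ V₀] [AddCommGroup V₁] [Module ℂ V₁]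

variable (d) in
/-- `(G, V)` is super multiplicity-free, for `V₀ = U₁ ⊕ ⋯ ⊕ U_k` and `V₁ = W₁ ⊕ ⋯ ⊕ W_l`:
`dim Hom_G(P^(i,j)(V), Γ) ≤ 1` for all multiindices `i`, `j` and all irreducible (holomorphic,
finite-dimensional) representations `Γ` of `G`. Up to isomorphism, each finite-dimensional
representation lives on a space in `Type`. -/
def IsSuperMF {ρ₀ : Representation ℂ G V₀} {ρ₁ : Representation ℂ G V₁} {k l : ℕ}
    (U : Fin k → Subrepresentation ρ₀) (W : Fin l → Subrepresentation ρ₁) : Prop :=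
  ∀ (i : Fin k → ℕ) (j : Fin l → ℕ) (Γ : Type) [AddCommGroup Γ] [Module ℂ Γ]
    [FiniteDimensional ℂ Γ] (σ : Representation ℂ G Γ), IsHolomorphic d σ → σ.IsIrreducible →
    Module.rank ℂ (Representation.IntertwiningMap (componentRep U W i j).toRepresentation σ) ≤ 1

end Main

/-! ### The saturated group -/

section Saturated

variable {G : Type*} [Group G]

/-- The saturated group `G̃ = (ℂˣ)^(k+l) × G`. -/
abbrev Saturated (k l : ℕ) (G : Type*) : Type _ := (Fin k ⊕ Fin l → ℂˣ) × G

variable {X : Type*} [AddCommGroup X] [Module ℂ X] {ρ : Representation ℂ G X} {n : ℕ}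

/-- The identification of the external direct sum `X₁ ⊕ ⋯ ⊕ X_n` with `X`. -/
def decompEquiv (N : Fin n → Subrepresentation ρ)
    (hN : DirectSum.IsInternal fun p => (N p).toSubmodule) :
    (DirectSum (Fin n) fun p => (N p).toSubmodule) ≃ₗ[ℂ] X :=
  LinearEquiv.ofBijective (DirectSum.coeLinearMap fun p => (N p).toSubmodule)
    (show Function.Bijective _ from hN)

lemma decompEquiv_lof (N : Fin n → Subrepresentation ρ)
    (hN : DirectSum.IsInternal fun p => (N p).toSubmodule) (p : Fin n) (x : (N p).toSubmodule) :
    decompEquiv N hN (DirectSum.lof ℂ (Fin n) (fun p => (N p).toSubmodule) p x) = x :=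
  DirectSum.coeLinearMap_lof _ _ _

/-- For a decomposition `X = X₁ ⊕ ⋯ ⊕ X_n` into `G`-submodules, the action of `(ℂˣ)^n × G` on `X`
for which `(t, g)` acts on `X_p` by `t_p • g` (see `scaledRep_apply`). -/
def scaledRep (N : Fin n → Subrepresentation ρ)
    (hN : DirectSum.IsInternal fun p => (N p).toSubmodule) :
    Representation ℂ ((Fin n → ℂˣ) × G) X where
  toFun x :=
    (decompEquiv N hN).toLinearMap ∘ₗ
      DirectSum.lmap (fun p => (x.1 p : ℂ) • (N p).toRepresentation x.2) ∘ₗ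
        (decompEquiv N hN).symm.toLinearMap
  map_one' := by
    ext v
    obtain ⟨v, rfl⟩ := (decompEquiv N hN).surjective v
    simp only [LinearMap.comp_apply, LinearEquiv.coe_coe, LinearEquiv.symm_apply_apply]
    have : (DirectSum.lmap fun p => (((1 : (Fin n → ℂˣ) × G).1 p : ℂˣ) : ℂ) •
        (N p).toRepresentation (1 : (Fin n → ℂˣ) × G).2) = LinearMap.id := by
      ext; simp
    rw [this]; rfl
  map_mul' a b := by
    ext v
    obtain ⟨v, rfl⟩ := (decompEquiv N hN).surjective v
    simp only [LinearMap.comp_apply, LinearEquiv.coe_coe, LinearEquiv.symm_apply_apply,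
      Module.End.mul_apply]
    rw [← LinearMap.comp_apply (DirectSum.lmap _) (DirectSum.lmap _)]
    congr 2
    ext
    simp [mul_smul, smul_comm (a.1 _ : ℂ)]

lemma scaledRep_apply (N : Fin n → Subrepresentation ρ)
    (hN : DirectSum.IsInternal fun p => (N p).toSubmodule) (t : Fin n → ℂˣ) (g : G) (p : Fin n)
    (x : X) (hx : x ∈ (N p).toSubmodule) :
    scaledRep N hN (t, g) x = (t p : ℂ) • ρ g x := by
  have h : (decompEquiv N hN).symm x
      = DirectSum.lof ℂ (Fin n) (fun p => (N p).toSubmodule) p ⟨x, hx⟩ := by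
    rw [LinearEquiv.symm_apply_eq, decompEquiv_lof]
  change decompEquiv N hN (DirectSum.lmap _ ((decompEquiv N hN).symm x)) = _
  rw [h, DirectSum.lmap_lof, decompEquiv_lof]
  rfl

variable {V₀ V₁ : Type*} [AddCommGroup V₀] [Module ℂ V₀] [AddCommGroup V₁] [Module ℂ V₁]
  {ρ₀ : Representation ℂ G V₀} {ρ₁ : Representation ℂ G V₁} {k l : ℕ}

/-- The saturated action of `G̃` on the even part: the first `k` copies of `ℂˣ` scale the
`U_p`, the others act trivially. -/
def saturatedEven (l : ℕ) (U : Fin k → Subrepresentation ρ₀)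
    (hU : DirectSum.IsInternal fun p => (U p).toSubmodule) :
    Representation ℂ (Saturated k l G) V₀ :=
  (scaledRep U hU).comp
    ((MonoidHom.pi fun p => Pi.evalMonoidHom (fun _ : Fin k ⊕ Fin l => ℂˣ) (Sum.inl p)).prodMap
      (MonoidHom.id G))

/-- The saturated action of `G̃` on the odd part: the last `l` copies of `ℂˣ` scale the
`W_q`, the others act trivially. -/
def saturatedOdd (k : ℕ) (W : Fin l → Subrepresentation ρ₁)
    (hW : DirectSum.IsInternal fun q => (W q).toSubmodule) :
    Representation ℂ (Saturated k l G) V₁ :=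
  (scaledRep W hW).comp
    ((MonoidHom.pi fun q => Pi.evalMonoidHom (fun _ : Fin k ⊕ Fin l => ℂˣ) (Sum.inr q)).prodMap
      (MonoidHom.id G))

end Saturated

end SuperMF

end

/-! The torus in $\tilde G$ separates the components: it acts on $P^{(i,j)}(V)$ by a character,
distinct indices give distinct characters, and $P(V)$ is the direct sum of the components. An
operator commuting with $\tilde G$ therefore preserves every component and restricts there to a
$G$-endomorphism. Conversely, extending a $G$-endomorphism of one component by zero gives a linear
operator on $P(V)$ that commutes with $\tilde G$. If every such extension can be matched on its
component by an invariant differential operator, then $PD(V)^{\tilde G}$ is commutative exactly when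
all algebras $\operatorname{End}_G(P^{(i,j)}(V))$ are.

The matching is `exists_mem_invDiffOps_eqOn_bidegree`, by a Capelli-type formula. The polarization
$\Omega = \sum_a (\cdot\, x_a) \otimes \partial_a$ on $P(V) \otimes P(V)$ commutes with the group.
By Euler's identity, $m$ even and $n$ odd polarizations turn $1 \otimes p$, with $p$ of bidegree
$(m,n)$, into $m!\,n!\,p \otimes 1$. Applying $T \otimes 1$, multiplying out and dividing by
$m!\,n!$ recovers $Tp$; expanded, this is a finite sum of terms $T(\text{monomial}) \cdot \partial
\cdots \partial$, hence a differential operator, whatever the linear map $T$ is.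

It remains that, for a semisimple module, commutativity of the endomorphism algebra is the same as
multiplicity at most one: `rank_intertwiningMap_le_one` and `commute_intertwiningMap`, both resting
on semisimplicity. The components are finite-dimensional and holomorphic, so they are semisimple by
Weyl's theorem. That theorem is derived from Whitehead's first lemma for Lie algebras and carried to
the connected group by differentiating the representation: a subspace is stable under $G$ if and
only if it is stable under the Lie algebra. -/

/-! ### Whitehead's first lemma and Weyl's theorem for Lie algebras with trivial radical. -/

section WeylTheorem

open LieAlgebra LieModule Module

variable {K L : Type*} [Field K] [LieRing L] [LieAlgebra K L]

omit [LieAlgebra K L] in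
/-- The canonical invariant tensor of a nondegenerate invariant form: the sum of `F (b i) (b' i)`
over a basis and its dual basis is annihilated by the Lie algebra action. -/
lemma sum_lie_dualBasis_eq_zero {J Z ι : Type*} [AddCommGroup J] [Module K J] [LieRingModule L J]
    [AddCommGroup Z] [Module K Z] [Fintype ι] [DecidableEq ι]
    {Φ : LinearMap.BilinForm K J} (hΦ : Φ.Nondegenerate) (hs : Φ.IsSymm)
    (hinv : Φ.lieInvariant L) (b : Basis ι K J) (F : J →ₗ[K] J →ₗ[K] Z) (y : L) :
    ∑ i, (F ⁅y, b i⁆ (Φ.dualBasis hΦ b i) + F (b i) ⁅y, Φ.dualBasis hΦ b i⁆) = 0 := by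
  set b' := Φ.dualBasis hΦ b
  have h1 (x : J) : x = ∑ j, Φ (b' j) x • b j := by
    conv_lhs => rw [← b.sum_repr x]
    refine Finset.sum_congr rfl fun j _ => ?_
    congr 1
    conv_lhs => rw [← LinearMap.BilinForm.dualBasis_dualBasis hΦ hs b]
    rw [LinearMap.BilinForm.dualBasis_repr_apply, hs.eq]
  have h2 (x : J) : x = ∑ j, Φ x (b j) • b' j := by
    conv_lhs => rw [← b'.sum_repr x]
    simp [b', LinearMap.BilinForm.dualBasis_repr_apply]
  rw [Finset.sum_add_distrib]
  -- Both halves are expanded in the same vectors `F (b j) (b' i)`; the two coefficients are then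
  -- opposite by invariance of `Φ`.
  have e1 : ∑ i, F ⁅y, b i⁆ (b' i) = ∑ i, ∑ j, Φ (b' j) ⁅y, b i⁆ • F (b j) (b' i) := by
    refine Finset.sum_congr rfl fun i _ => ?_
    conv_lhs => rw [h1 ⁅y, b i⁆]
    simp [map_sum]
  have e2 : ∑ j, F (b j) ⁅y, b' j⁆ = ∑ i, ∑ j, Φ ⁅y, b' j⁆ (b i) • F (b j) (b' i) := by
    rw [Finset.sum_comm]
    refine Finset.sum_congr rfl fun i _ => ?_
    conv_lhs => rw [h2 ⁅y, b' i⁆]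
    simp [map_sum]
  rw [e1, e2, ← Finset.sum_add_distrib]
  refine Finset.sum_eq_zero fun i _ => ?_
  rw [← Finset.sum_add_distrib]
  refine Finset.sum_eq_zero fun j _ => ?_
  rw [← add_smul, hinv y (b' j) (b i)]
  simp

section Cocycle

variable {M : Type*} [AddCommGroup M] [Module K M] [LieRingModule L M] [LieModule K L M]

/-- The Casimir construction turns a cocycle `δ` into an element whose coboundary is `c ∘ δ`. -/
lemma lie_sum_lie_cocycle {ι : Type*} [Fintype ι] [DecidableEq ι]
    (J : LieIdeal K L) {Φ : LinearMap.BilinForm K J} (hΦ : Φ.Nondegenerate) (hs : Φ.IsSymm)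
    (hinv : Φ.lieInvariant L) (b : Basis ι K J) (δ : L →ₗ[K] M)
    (hδ : ∀ x y, δ ⁅x, y⁆ = ⁅x, δ y⁆ - ⁅y, δ x⁆) (y : L) :
    ⁅y, ∑ i, ⁅(b i : L), δ (Φ.dualBasis hΦ b i : L)⁆⁆ =
      ∑ i, ⁅(b i : L), ⁅(Φ.dualBasis hΦ b i : L), δ y⁆⁆ := by
  have key := sum_lie_dualBasis_eq_zero hΦ hs hinv b
    (((LieModule.toEnd K L M : L →ₗ[K] Module.End K M).compl₂ δ).compl₁₂
      J.toSubmodule.subtype J.toSubmodule.subtype) y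
  -- By the Leibniz and cocycle rules, the difference of the two sides is, term by term, the
  -- invariant-tensor sum for the bilinear map `(u, v) ↦ ⁅u, δ v⁆`.
  rw [lie_sum, ← sub_eq_zero, ← Finset.sum_sub_distrib, ← key]
  refine Finset.sum_congr rfl fun i _ => ?_
  have e (u v : J) : (((LieModule.toEnd K L M : L →ₗ[K] Module.End K M).compl₂ δ).compl₁₂
      J.toSubmodule.subtype J.toSubmodule.subtype) u v = ⁅(u : L), δ (v : L)⁆ := rfl
  rw [e, e, LieSubmodule.coe_bracket, LieSubmodule.coe_bracket, hδ, lie_sub, leibniz_lie]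
  abel

end Cocycle

variable [FiniteDimensional K L] [HasTrivialRadical K L] [CharZero K]

/-- A Lie algebra with trivial radical is perfect. -/
lemma lie_top_top_eq_top : ⁅(⊤ : LieIdeal K L), (⊤ : LieIdeal K L)⁆ = ⊤ := by
  set I := ⁅(⊤ : LieIdeal K L), (⊤ : LieIdeal K L)⁆
  have hc := LieIdeal.isCompl_killingCompl I
  -- Brackets of elements of the complement lie both in the derived ideal and in the complement, so
  -- they vanish; an abelian ideal is zero because the radical is.
  have habs : IsLieAbelian I.killingCompl := by
    rw [LieSubmodule.lie_abelian_iff_lie_self_eq_bot]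
    refine le_bot_iff.mp (hc.inf_eq_bot ▸ le_inf ?_ ?_)
    · exact LieSubmodule.mono_lie le_top le_top
    · exact LieSubmodule.lie_le_left _ _
  have : I.killingCompl = ⊥ :=
    HasTrivialRadical.eq_bot_of_isSolvable (R := K) I.killingCompl
  simpa [this] using hc.sup_eq_top

section H1

variable {M : Type*} [AddCommGroup M] [Module K M] [LieRingModule L M] [LieModule K L M]

-- For a trivial action the cocycle rule says that `δ` kills brackets, and these span the perfect
-- algebra `L`.
omit [LieModule K L M] in
lemma cocycle_eq_zero_of_isTrivial [LieModule.IsTrivial L M] (δ : L →ₗ[K] M)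
    (hδ : ∀ x y, δ ⁅x, y⁆ = ⁅x, δ y⁆ - ⁅y, δ x⁆) : δ = 0 := by
  have h : (⁅(⊤ : LieIdeal K L), (⊤ : LieIdeal K L)⁆).toSubmodule ≤ LinearMap.ker δ := by
    rw [LieSubmodule.lieIdeal_oper_eq_linear_span', Submodule.span_le]
    rintro _ ⟨x, -, y, -, rfl⟩
    simp [hδ, LieModule.IsTrivial.trivial]
  rw [lie_top_top_eq_top] at h
  ext x
  exact h (Submodule.mem_top (x := x))

variable [FiniteDimensional K M]

omit [FiniteDimensional K M] in
/-- A module whose trace form is nonzero carries a nontrivial Casimir operator: there is an ideal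
on which the trace form is nondegenerate. -/
lemma exists_ideal_traceForm_nondegenerate (h : traceForm K L M ≠ 0) :
    ∃ J : LieIdeal K L, J ≠ ⊥ ∧ ((traceForm K L M).restrict J.toSubmodule).Nondegenerate := by
  set β := traceForm K L M
  -- The radical of the trace form; its Killing complement will be the required ideal.
  set I : LieIdeal K L := InvariantForm.orthogonal β (traceForm_lieInvariant K L M) ⊤
  have hI (x : L) : x ∈ I ↔ ∀ y, β y x = 0 := by
    simp [I, InvariantForm.mem_orthogonal]
  have hc := LieIdeal.isCompl_killingCompl I
  refine ⟨I.killingCompl, fun hb => h ?_, ?_⟩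
  · have : I = ⊤ := by simpa [hb] using hc.sup_eq_top
    ext y x
    simpa using (hI x).mp (this ▸ LieSubmodule.mem_top x) y
  · have hs : (β.restrict I.killingCompl.toSubmodule).IsRefl := by
      intro x y hxy
      exact (traceForm_comm K L M _ _).trans hxy
    rw [LinearMap.BilinForm.nondegenerate_iff_ker_eq_bot] 
    · rw [LinearMap.ker_eq_bot']
      rintro ⟨x, hx⟩ hx0
      -- Since `L` is the sum of the radical and its complement, an element orthogonal to the
      -- complement is orthogonal to all of `L`.
      have : x ∈ I ⊓ I.killingCompl := by
        refine ⟨(hI x).mpr fun y => ?_, hx⟩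
        obtain ⟨u, hu, v, hv, rfl⟩ :=
          (LieSubmodule.mem_sup (I) (I.killingCompl) y).mp (hc.sup_eq_top ▸ LieSubmodule.mem_top y)
        have h1 : β u x = 0 := by
          rw [traceForm_comm]; exact (hI u).mp hu x
        have h2 : β x v = 0 := LinearMap.congr_fun hx0 ⟨v, hv⟩
        rw [traceForm_comm] at h2
        simp [h1, β, h2]
      rw [hc.inf_eq_bot] at this
      exact Subtype.ext (by simpa using this)

/-- If the trace form vanishes, Cartan's criterion makes the derived algebra, which is all of `L`,
act nilpotently; invariant vectors exist, so irreducibility makes the action trivial and `δ` is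
zero. Otherwise a Casimir operator `c` of an ideal `J` has trace `dim J ≠ 0` and commutes with `L`,
so it is invertible by irreducibility. Since `c ∘ δ` is a coboundary, so is `δ`. -/
lemma exists_coboundary_of_irreducible (hM : ∀ N : LieSubmodule K L M, N = ⊥ ∨ N = ⊤)
    (δ : L →ₗ[K] M) (hδ : ∀ x y, δ ⁅x, y⁆ = ⁅x, δ y⁆ - ⁅y, δ x⁆) :
    ∃ m, ∀ x, δ x = ⁅x, m⁆ := by
  rcases subsingleton_or_nontrivial M with hsub | hnt
  · exact ⟨0, fun x => Subsingleton.elim _ _⟩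
  by_cases h : traceForm K L M = 0
  · have hn := LieModule.isNilpotent_derivedSeries_of_traceForm_eq_zero h
    have hL : LieModule.IsNilpotent L M := by
      rw [LieModule.isNilpotent_iff_forall' (R := K)] at hn ⊢
      intro x
      have hx : x ∈ derivedSeries K L 1 := by
        rw [LieAlgebra.derivedSeries_def, LieAlgebra.derivedSeriesOfIdeal_succ,
          LieAlgebra.derivedSeriesOfIdeal_zero, lie_top_top_eq_top]
        exact LieSubmodule.mem_top x
      exact hn ⟨x, hx⟩
    have hmax := LieModule.nontrivial_max_triv_of_isNilpotent K L M
    have htop : maxTrivSubmodule K L M = ⊤ := by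
      refine (hM _).resolve_left fun hb => ?_
      exact (LieSubmodule.nontrivial_iff_ne_bot K L M).mp hmax hb
    have : LieModule.IsTrivial L M := (LieModule.isTrivial_iff_max_triv_eq_top K L M).mpr htop
    exact ⟨0, fun x => by simp [cocycle_eq_zero_of_isTrivial δ hδ]⟩
  · obtain ⟨J, hJ, hΦ⟩ := exists_ideal_traceForm_nondegenerate h
    set Φ : LinearMap.BilinForm K J := (traceForm K L M).restrict J.toSubmodule
    have hs : Φ.IsSymm := ⟨fun x y => traceForm_comm K L M _ _⟩
    have hinv : Φ.lieInvariant L := fun x y z => traceForm_lieInvariant K L M x y z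
    let b := Module.finBasis K J
    set b' := Φ.dualBasis hΦ b
    let c : Module.End K M := ∑ i, toEnd K L M (b i) ∘ₗ toEnd K L M (b' i)
    have hc (m : M) : c m = ∑ i, ⁅(b i : L), ⁅(b' i : L), m⁆⁆ := by
      simp [c, LinearMap.sum_apply]
    have hcomm (x : L) (m : M) : c ⁅x, m⁆ = ⁅x, c m⁆ := by
      have := lie_sum_lie_cocycle J hΦ hs hinv b
        ((toEnd K L M : L →ₗ[K] Module.End K M).flip m)
        (fun x y => by simp) x
      simp only [LinearMap.flip_apply, LieHom.coe_toLinearMap, toEnd_apply_apply] at this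
      rw [hc, hc, this]
    have htr : LinearMap.trace K M c = (finrank K J : K) := by
      have h1 (i : Fin (finrank K J)) :
          LinearMap.trace K M (toEnd K L M (b i) ∘ₗ toEnd K L M (b' i)) = 1 := by
        change Φ (b i) (b' i) = 1
        rw [LinearMap.BilinForm.apply_dualBasis_right hΦ hs, if_pos rfl]
      simp [c, map_sum, h1]
    have hJ0 : (finrank K J : K) ≠ 0 := by
      have : Nontrivial J := (LieSubmodule.nontrivial_iff_ne_bot K L L).mpr hJ
      exact_mod_cast finrank_pos.ne'
    let N : LieSubmodule K L M :=
      { LinearMap.ker c with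
        lie_mem := fun {x m} hm => by
          change c ⁅x, m⁆ = 0
          rw [hcomm, show c m = 0 from hm, lie_zero] }
    have hker : LinearMap.ker c = ⊥ := by
      rcases hM N with hN | hN
      · exact (LieSubmodule.toSubmodule_eq_bot N).mpr hN
      · exfalso
        have hc0 : c = 0 := by
          ext m
          exact (hN ▸ LieSubmodule.mem_top m : m ∈ N)
        rw [hc0, map_zero] at htr
        exact hJ0 htr.symm
    have hinj : Function.Injective c := LinearMap.ker_eq_bot.mp hker
    obtain ⟨m, hm⟩ := (LinearMap.injective_iff_surjective.mp hinj)
      (∑ i, ⁅(b i : L), δ (b' i : L)⁆)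
    refine ⟨m, fun x => hinj ?_⟩
    rw [hcomm, hm, hc, lie_sum_lie_cocycle J hΦ hs hinv b δ hδ x]

end H1

universe u in
/-- **Whitehead's first lemma**: every cocycle of a Lie algebra with trivial radical with values in
a finite-dimensional module is a coboundary. -/
theorem exists_coboundary {M : Type u} [AddCommGroup M] [Module K M] [LieRingModule L M]
    [LieModule K L M] [FiniteDimensional K M]
    (δ : L →ₗ[K] M) (hδ : ∀ x y, δ ⁅x, y⁆ = ⁅x, δ y⁆ - ⁅y, δ x⁆) :
    ∃ m, ∀ x, δ x = ⁅x, m⁆ := by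
  suffices H : ∀ (n : ℕ) (M : Type u) [AddCommGroup M] [Module K M] [LieRingModule L M]
      [LieModule K L M] [FiniteDimensional K M] (δ : L →ₗ[K] M)
      (_ : ∀ x y, δ ⁅x, y⁆ = ⁅x, δ y⁆ - ⁅y, δ x⁆), finrank K M ≤ n →
      ∃ m, ∀ x, δ x = ⁅x, m⁆ from H _ M δ hδ le_rfl
  intro n
  induction n with
  | zero =>
    intro M _ _ _ _ _ δ hδ hn
    have : Subsingleton M := finrank_zero_iff.mp (Nat.le_zero.mp hn)
    exact ⟨0, fun x => Subsingleton.elim _ _⟩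
  | succ n ih =>
    intro M _ _ _ _ _ δ hδ hn
    by_cases hM : ∀ N : LieSubmodule K L M, N = ⊥ ∨ N = ⊤
    · exact exists_coboundary_of_irreducible hM δ hδ
    push Not at hM
    obtain ⟨N, hN0, hN1⟩ := hM
    have hN0' : N.toSubmodule ≠ ⊥ := fun h => hN0 ((LieSubmodule.toSubmodule_eq_bot N).mp h)
    have hN1' : N.toSubmodule ≠ ⊤ := fun h => hN1 ((LieSubmodule.toSubmodule_eq_top N).mp h)
    have hq : finrank K (M ⧸ N) ≤ n := by
      have h1 := N.toSubmodule.finrank_quotient_add_finrank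
      have h2 := Nat.pos_of_ne_zero fun h => hN0' (Submodule.finrank_eq_zero.mp h)
      change finrank K (M ⧸ N.toSubmodule) ≤ n
      omega
    have hs : finrank K N ≤ n := by
      have := Submodule.finrank_lt (s := N.toSubmodule) hN1'
      change finrank K N.toSubmodule ≤ n
      omega
    -- Modulo `N` the cocycle is a coboundary; subtracting a lift of that coboundary leaves a
    -- cocycle with values in `N`, of smaller dimension.
    obtain ⟨mq, hmq⟩ := ih (M ⧸ N) ((LieSubmodule.Quotient.mk' N : M →ₗ[K] M ⧸ N) ∘ₗ δ)
      (fun x y => by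
        change LieSubmodule.Quotient.mk' N (δ ⁅x, y⁆) = ⁅x, LieSubmodule.Quotient.mk' N (δ y)⁆ -
          ⁅y, LieSubmodule.Quotient.mk' N (δ x)⁆
        rw [hδ, map_sub, LieModuleHom.map_lie, LieModuleHom.map_lie]) hq
    obtain ⟨m, rfl⟩ := LieSubmodule.Quotient.surjective_mk' N mq
    have hmem (x : L) : δ x - ⁅x, m⁆ ∈ N.toSubmodule := by
      have h1 := hmq x
      rw [← (LieSubmodule.Quotient.mk' N).map_lie] at h1
      have h2 : LieSubmodule.Quotient.mk' N (δ x - ⁅x, m⁆) = 0 := by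
        rw [map_sub, sub_eq_zero]; exact h1
      exact (LieSubmodule.Quotient.mk_eq_zero N).mp h2
    let δ' : L →ₗ[K] N := LinearMap.codRestrict N.toSubmodule
      (δ - (toEnd K L M : L →ₗ[K] Module.End K M).flip m) (fun x => by simpa using hmem x)
    have hδ' (x : L) : (δ' x : M) = δ x - ⁅x, m⁆ := rfl
    obtain ⟨m', hm'⟩ := ih N δ' (fun x y => by
      apply Subtype.ext
      rw [LieSubmodule.coe_sub, LieSubmodule.coe_bracket, LieSubmodule.coe_bracket, hδ', hδ', hδ',
        hδ, lie_sub, lie_sub, lie_lie]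
      abel) hs
    refine ⟨m + m', fun x => ?_⟩
    have := congrArg (Subtype.val) (hm' x)
    rw [hδ', LieSubmodule.coe_bracket] at this
    rw [lie_add, ← this]
    abel

/-- **Weyl's theorem** on complete reducibility. -/
theorem LieSubmodule.exists_isCompl_of_hasTrivialRadical {V : Type*} [AddCommGroup V] [Module K V]
    [LieRingModule L V] [LieModule K L V] [FiniteDimensional K V] (W : LieSubmodule K L V) :
    ∃ W' : LieSubmodule K L V, IsCompl W.toSubmodule W'.toSubmodule := by
  -- The maps into `W` that vanish on `W`: correcting a projection onto `W` by an element of `E`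
  -- gives another projection onto `W`.
  let E : LieSubmodule K L (V →ₗ[K] V) :=
    { carrier := {f | (∀ v, f v ∈ W) ∧ ∀ w ∈ W, f w = 0}
      add_mem' := fun {f g} hf hg =>
        ⟨fun v => W.add_mem (hf.1 v) (hg.1 v), fun w hw => by simp [hf.2 w hw, hg.2 w hw]⟩
      zero_mem' := ⟨fun v => W.zero_mem, fun w _ => rfl⟩
      smul_mem' := fun c f hf => ⟨fun v => W.smul_mem c (hf.1 v), fun w hw => by simp [hf.2 w hw]⟩
      lie_mem := fun {x f} hf => ⟨fun v => by
          rw [LieHom.lie_apply]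
          exact W.sub_mem (W.lie_mem (hf.1 v)) (hf.1 _), fun w hw => by
          rw [LieHom.lie_apply, hf.2 w hw, hf.2 _ (W.lie_mem hw)]; simp⟩ }
  obtain ⟨p, hp⟩ := W.toSubmodule.subtype.exists_leftInverse_of_injective
    (Submodule.ker_subtype W.toSubmodule)
  let P : V →ₗ[K] V := W.toSubmodule.subtype ∘ₗ p
  have hP1 (v : V) : P v ∈ W := (p v).2
  have hP2 (w : V) (hw : w ∈ W) : P w = w :=
    congrArg Subtype.val (LinearMap.congr_fun hp ⟨w, hw⟩)
  -- This is the coboundary of `P` in `End V`, and it takes values in `E` because `P` is the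
  -- identity on `W`. Whitehead's lemma makes it a coboundary inside `E`, and the correction turns
  -- `P` into an equivariant projection, whose kernel is the complement.
  let δ : L →ₗ[K] E := LinearMap.codRestrict E.toSubmodule
    ((toEnd K L (V →ₗ[K] V) : L →ₗ[K] Module.End K (V →ₗ[K] V)).flip P) (fun x => by
      refine ⟨fun v => ?_, fun w hw => ?_⟩
      · change ⁅x, P⁆ v ∈ W
        rw [LieHom.lie_apply]
        exact W.sub_mem (W.lie_mem (hP1 v)) (hP1 _)
      · change ⁅x, P⁆ w = 0
        rw [LieHom.lie_apply, hP2 w hw, hP2 _ (W.lie_mem hw), sub_self])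
  have hδ (x : L) : (δ x : V →ₗ[K] V) = ⁅x, P⁆ := rfl
  obtain ⟨m, hm⟩ := exists_coboundary δ (fun x y => by
    apply Subtype.ext
    rw [LieSubmodule.coe_sub, LieSubmodule.coe_bracket, LieSubmodule.coe_bracket, hδ, hδ, hδ,
      lie_lie])
  let Q : V →ₗ[K] V := P - m
  have hQ (x : L) (v : V) : Q ⁅x, v⁆ = ⁅x, Q v⁆ := by
    have h0 : ⁅x, Q⁆ = 0 := by
      have := congrArg Subtype.val (hm x)
      rw [hδ, LieSubmodule.coe_bracket] at this
      simp only [Q, lie_sub, this, sub_self]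
    have := LinearMap.congr_fun h0 v
    rw [LieHom.lie_apply, LinearMap.zero_apply, sub_eq_zero] at this
    exact this.symm
  have hQ1 (v : V) : Q v ∈ W := W.sub_mem (hP1 v) (m.2.1 v)
  have hQ2 (w : V) (hw : w ∈ W) : Q w = w := by
    simp [Q, hP2 w hw, m.2.2 w hw]
  refine ⟨{ LinearMap.ker Q with
    lie_mem := fun {x v} hv => by
      change Q ⁅x, v⁆ = 0
      rw [hQ, show Q v = 0 from hv, lie_zero] }, ?_⟩
  rw [isCompl_iff, Submodule.disjoint_def, codisjoint_iff, eq_top_iff]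
  refine ⟨fun v hv hv' => (hQ2 v hv).symm.trans hv', fun v _ => ?_⟩
  refine Submodule.mem_sup.mpr ⟨Q v, hQ1 v, v - Q v, ?_, by abel⟩
  change Q (v - Q v) = 0
  rw [map_sub, hQ2 _ (hQ1 v), sub_self]

end WeylTheorem

/-! ### Derivatives of functions along Lie brackets of vector fields. -/

section LieBracketApply

open VectorField Set Filter
open scoped Topology

variable {𝕜 : Type*} [NontriviallyNormedField 𝕜] {H : Type*} [TopologicalSpace H]
  {E : Type*} [NormedAddCommGroup E] [NormedSpace 𝕜 E] {I : ModelWithCorners 𝕜 E H}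
  {M : Type*} [TopologicalSpace M] [ChartedSpace H M]
  {F : Type*} [NormedAddCommGroup F] [NormedSpace 𝕜 F]

lemma fderivWithin_comp_extChartAt_symm [IsManifold I 1 M] {x : M} {g : M → F} {y : E}
    (hy : y ∈ (extChartAt I x).target)
    (hg : MDifferentiableAt I 𝓘(𝕜, F) g ((extChartAt I x).symm y)) :
    fderivWithin 𝕜 (g ∘ (extChartAt I x).symm) (range I) y =
      (mvfderiv I g ((extChartAt I x).symm y)).comp
        (mfderivWithin 𝓘(𝕜, E) I (extChartAt I x).symm (range I) y) := by
  have h1 := mfderiv_comp_mfderivWithin (I := 𝓘(𝕜, E)) (I' := I) (I'' := 𝓘(𝕜, F)) y hg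
    (mdifferentiableWithinAt_extChartAt_symm hy)
    (I.uniqueMDiffOn y (extChartAt_target_subset_range x hy))
  rw [mfderivWithin_eq_fderivWithin] at h1
  exact h1

/-- The inverse differential is how a vector field is pulled back to a chart, so this says that
derivatives along fields can be computed there. -/
lemma fderivWithin_comp_extChartAt_symm_inverse [IsManifold I 1 M] [CompleteSpace E]
    {x : M} {g : M → F} {y : E}
    (hy : y ∈ (extChartAt I x).target)
    (hg : MDifferentiableAt I 𝓘(𝕜, F) g ((extChartAt I x).symm y))
    (u : TangentSpace I ((extChartAt I x).symm y)) :
    fderivWithin 𝕜 (g ∘ (extChartAt I x).symm) (range I) y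
      ((mfderivWithin 𝓘(𝕜, E) I (extChartAt I x).symm (range I) y).inverse u) =
      mvfderiv I g ((extChartAt I x).symm y) u := by
  have h2 := ContinuousLinearMap.IsInvertible.self_comp_inverse
    (isInvertible_mfderivWithin_extChartAt_symm (I := I) hy)
  rw [fderivWithin_comp_extChartAt_symm hy hg]
  change mvfderiv I g _ (((mfderivWithin 𝓘(𝕜, E) I (extChartAt I x).symm (range I) y).comp
    (mfderivWithin 𝓘(𝕜, E) I (extChartAt I x).symm (range I) y).inverse) u) = _
  rw [h2]
  rfl

lemma mvfderiv_inverse_mfderiv_extChartAt [IsManifold I 1 M] {x : M} {g : M → F}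
    (hg : MDifferentiableAt I 𝓘(𝕜, F) g x) (u : E) :
    mvfderiv I g x ((mfderiv I 𝓘(𝕜, E) (extChartAt I x) x).inverse u) =
      fderivWithin 𝕜 (g ∘ (extChartAt I x).symm) (range I) (extChartAt I x x) u := by
  have hy := mem_extChartAt_target (I := I) x
  rw [fderivWithin_comp_extChartAt_symm hy (by rwa [extChartAt_to_inv])]
  have h3 : (mfderiv I 𝓘(𝕜, E) (extChartAt I x) x).inverse =
      mfderivWithin 𝓘(𝕜, E) I (extChartAt I x).symm (range I) (extChartAt I x x) :=
    ContinuousLinearMap.inverse_eq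
      (mfderiv_extChartAt_comp_mfderivWithin_extChartAt_symm' (mem_extChartAt_source x))
      (mfderivWithin_extChartAt_symm_comp_mfderiv_extChartAt' (mem_extChartAt_source x))
  rw [h3, extChartAt_to_inv]
  rfl

/-- The derivative of a function along the Lie bracket of two vector fields is the commutator of
the derivatives along the two fields. -/
lemma mvfderiv_mlieBracket_apply {n : ℕ∞ω} (hn : minSmoothness 𝕜 2 ≤ n) [IsManifold I n M]
    [IsManifold I 1 M]
    [CompleteSpace E] {V W : Π x : M, TangentSpace I x} {x : M}
    {f a b : M → F} (hf : ContMDiff I 𝓘(𝕜, F) n f)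
    (hV : MDifferentiableAt I I.tangent (fun y => (V y : TangentBundle I M)) x)
    (hW : MDifferentiableAt I I.tangent (fun y => (W y : TangentBundle I M)) x)
    (ha : ∀ y, mvfderiv I f y (V y) = a y) (hb : ∀ y, mvfderiv I f y (W y) = b y)
    (ha' : MDifferentiableAt I 𝓘(𝕜, F) a x) (hb' : MDifferentiableAt I 𝓘(𝕜, F) b x) :
    mvfderiv I f x (mlieBracket I V W x) = mvfderiv I b x (V x) - mvfderiv I a x (W x) := by
  have hn2 : 2 ≤ n := le_minSmoothness.trans hn
  have : IsManifold I 2 M := IsManifold.of_le hn2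
  have hn0 : n ≠ 0 := (lt_of_lt_of_le (by simp) hn2).ne'
  have hfd : MDifferentiable I 𝓘(𝕜, F) f := hf.mdifferentiable hn0
  rw [← mlieBracketWithin_univ, mlieBracketWithin_apply]
  refine (mvfderiv_inverse_mfderiv_extChartAt (hfd x) _).trans ?_
  have hVd := hV.mdifferentiableWithinAt.differentiableWithinAt_mpullbackWithin_vectorField
    (s := univ)
  have hWd := hW.mdifferentiableWithinAt.differentiableWithinAt_mpullbackWithin_vectorField
    (s := univ)
  simp only [preimage_univ, univ_inter] at hVd hWd ⊢
  have hx := mem_extChartAt_target (I := I) x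
  have hxr : extChartAt I x x ∈ range I := mem_range_self _
  -- The identity holds only on the chart target; that is a neighbourhood within `range I`, which is
  -- enough to differentiate it once more at the base point.
  have hev (X : Π x : M, TangentSpace I x) (c : M → F)
      (hc : ∀ y, mvfderiv I f y (X y) = c y) :
      (fun y => fderivWithin 𝕜 (f ∘ (extChartAt I x).symm) (range I) y
        (mpullbackWithin 𝓘(𝕜, E) I (extChartAt I x).symm X (range I) y)) =ᶠ[𝓝[range I]
          (extChartAt I x x)] c ∘ (extChartAt I x).symm := by
    filter_upwards [extChartAt_target_mem_nhdsWithin (I := I) x] with y hy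
    exact (fderivWithin_comp_extChartAt_symm_inverse hy (hfd _) _).trans (hc _)
  have hpt (g : M → F) (X : Π x : M, TangentSpace I x) (hg : MDifferentiableAt I 𝓘(𝕜, F) g x) :
      fderivWithin 𝕜 (g ∘ (extChartAt I x).symm) (range I) (extChartAt I x x)
        (mpullbackWithin 𝓘(𝕜, E) I (extChartAt I x).symm X (range I) (extChartAt I x x)) =
      mvfderiv I g x (X x) := by
    refine (fderivWithin_comp_extChartAt_symm_inverse hx (by rwa [extChartAt_to_inv]) _).trans ?_
    rw [extChartAt_to_inv]
  have hfc : ContDiffWithinAt 𝕜 n (f ∘ (extChartAt I x).symm) (range I) (extChartAt I x x) := by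
    have := hf.contMDiffAt.comp_contMDiffWithinAt (extChartAt I x x)
      (contMDiffWithinAt_extChartAt_symm_range (n := n) x hx)
    exact contMDiffWithinAt_iff_contDiffWithinAt.mp this
  -- In the model space the formula is the symmetry of the second derivative of `f`.
  refine (fderivWithin_apply_lieBracket (n := n) hfc hn I.uniqueDiffOn
    (I.range_subset_closure_interior hxr) hxr hWd hVd).trans ?_
  rw [(hev W b hb).fderivWithin_eq ((hev W b hb).self_of_nhdsWithin hxr),
      (hev V a ha).fderivWithin_eq ((hev V a ha).self_of_nhdsWithin hxr),
      hpt b V hb', hpt a W ha']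

end LieBracketApply

/-! ### The differential of a Lie group homomorphism. -/

section HomDerivative

open Set Filter
open scoped Topology

variable {𝕜 : Type*} [NontriviallyNormedField 𝕜] {H : Type*} [TopologicalSpace H]
  {E : Type*} [NormedAddCommGroup E] [NormedSpace 𝕜 E] {I : ModelWithCorners 𝕜 E H}

lemma mvfderiv_clm_comp {M : Type*} [TopologicalSpace M] [ChartedSpace H M]
    {F F' : Type*} [NormedAddCommGroup F] [NormedSpace 𝕜 F]
    [NormedAddCommGroup F'] [NormedSpace 𝕜 F'] (T : F →L[𝕜] F') {g : M → F} {x : M}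
    (hg : MDifferentiableAt I 𝓘(𝕜, F) g x) :
    mvfderiv I (T ∘ g) x = T.comp (mvfderiv I g x) := by
  have h := mfderiv_comp x (T.mdifferentiableAt (x := g x)) hg
  rw [T.mfderiv_eq] at h
  exact h

variable {G : Type*} [TopologicalSpace G] [ChartedSpace H G] [Group G]
  [LieGroup I (minSmoothness 𝕜 3) G]
  {A : Type*} [NormedRing A] [NormedAlgebra 𝕜 A]
  {R : G →* A}

/-- Differentiate `R (g * x) = R g * R x` in `x`. The product is a separate variable `k` so that `g
* 1` and `g⁻¹ * g` can be replaced by `g` and `1`, on which the tangent space depends. -/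
lemma mvfderiv_monoidHom_mul_left (hR : MDifferentiable I 𝓘(𝕜, A) R) {g h k : G} (hk : g * h = k)
    (u : TangentSpace I h) :
    mvfderiv I R k (mfderiv I I (fun x => g * x) h u) = R g * mvfderiv I R h u := by
  have M : minSmoothness 𝕜 3 ≠ 0 := lt_of_lt_of_le (by simp) le_minSmoothness |>.ne'
  have h1 : (R ∘ fun h => g * h) = (ContinuousLinearMap.mul 𝕜 A (R g)) ∘ R := by
    ext h; simp
  have hmul : MDifferentiableAt I I (fun h : G => g * h) h :=
    (contMDiff_mul_left (n := minSmoothness 𝕜 3)).contMDiffAt.mdifferentiableAt M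
  have h2 : mvfderiv I (R ∘ fun h => g * h) h =
      (mvfderiv I R k).comp (mfderiv I I (fun x => g * x) h) :=
    hk ▸ mfderiv_comp h (hR _) hmul
  rw [h1, mvfderiv_clm_comp _ (hR h)] at h2
  exact (DFunLike.congr_fun h2 u).symm

/-- The differential of a smooth homomorphism from a Lie group to the unit group of a normed
algebra is a homomorphism of Lie algebras. -/
lemma mvfderiv_monoidHom_lie [CompleteSpace E] (hR : ContMDiff I 𝓘(𝕜, A) (minSmoothness 𝕜 3) R)
    (v w : GroupLieAlgebra I G) :
    mvfderiv I R 1 (⁅v, w⁆ : GroupLieAlgebra I G) =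
      mvfderiv I R 1 v * mvfderiv I R 1 w - mvfderiv I R 1 w * mvfderiv I R 1 v := by
  have M : minSmoothness 𝕜 3 ≠ 0 := lt_of_lt_of_le (by simp) le_minSmoothness |>.ne'
  have hRd := hR.mdifferentiable M
  -- Along a left-invariant field, `R` is differentiated into `R` times a constant; this is again a
  -- continuous linear image of `R`, so the second derivatives at `1` are products of first ones.
  have hX (v : GroupLieAlgebra I G) (g : G) :
      mvfderiv I R g (mulInvariantVectorField v g) = R g * mvfderiv I R 1 v :=
    mvfderiv_monoidHom_mul_left hRd (mul_one g) v
  let T (w : GroupLieAlgebra I G) : A →L[𝕜] A :=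
    (ContinuousLinearMap.mul 𝕜 A).flip (mvfderiv I R 1 w)
  have hb (w : GroupLieAlgebra I G) : MDifferentiableAt I 𝓘(𝕜, A) (T w ∘ R) 1 :=
    (T w).mdifferentiableAt.comp (1 : G) (hRd 1)
  have h1 (v : GroupLieAlgebra I G) : mulInvariantVectorField v (1 : G) = v := by
    have : (fun x : G => 1 * x) = id := by ext x; simp
    rw [mulInvariantVectorField, this, mfderiv_id]
    rfl
  rw [GroupLieAlgebra.bracket_def,
    mvfderiv_mlieBracket_apply (n := minSmoothness 𝕜 3) (minSmoothness_monotone (by norm_cast)) hR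
    (mdifferentiableAt_mulInvariantVectorField v) (mdifferentiableAt_mulInvariantVectorField w)
    (a := T v ∘ R) (b := T w ∘ R) (hX v) (hX w) (hb v) (hb w),
    mvfderiv_clm_comp _ (hRd 1), mvfderiv_clm_comp _ (hRd 1), h1, h1]
  rfl

end HomDerivative

/-! ### Passing between the values of a homomorphism and those of its differential. -/

section Invariance

open Set Filter
open scoped Topology

/-- Right multiplication by an element of `S` descends to `A ⧸ S`, so `r` may be replaced by a
representative of almost minimal norm. This supplies the growth estimate for the differential
equation `r' = r s` modulo `S`. -/
lemma Submodule.Quotient.norm_mk_mul_le {A : Type*} [NormedRing A] [NormedAlgebra ℂ A]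
    (S : Subalgebra ℂ A) (r : A) {s : A} (hs : s ∈ S) :
    ‖(Submodule.Quotient.mk (r * s) : A ⧸ Subalgebra.toSubmodule S)‖ ≤
      ‖s‖ * ‖(Submodule.Quotient.mk r : A ⧸ Subalgebra.toSubmodule S)‖ := by
  refine le_of_forall_pos_le_add fun ε hε => ?_
  obtain ⟨δ, hδ, hδε⟩ : ∃ δ > 0, ‖s‖ * δ ≤ ε :=
    ⟨ε / (‖s‖ + 1), by positivity, by
      rw [mul_div_assoc', div_le_iff₀ (by positivity)]; nlinarith [norm_nonneg s]⟩
  obtain ⟨r', hr', hlt⟩ := Submodule.Quotient.norm_mk_lt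
    (Submodule.Quotient.mk r : A ⧸ Subalgebra.toSubmodule S) hδ
  have h1 : (Submodule.Quotient.mk (r * s) : A ⧸ Subalgebra.toSubmodule S) =
      Submodule.Quotient.mk (r' * s) := by
    rw [Submodule.Quotient.eq] at hr' ⊢
    have h2 : r' - r ∈ S := hr'
    have h3 : (r - r') * s ∈ S := by
      rw [← neg_sub r' r]; exact S.mul_mem (S.neg_mem h2) hs
    rwa [sub_mul] at h3
  calc _ ≤ ‖r' * s‖ := h1 ▸ Submodule.Quotient.norm_mk_le _ _
    _ ≤ ‖r'‖ * ‖s‖ := norm_mul_le _ _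
    _ ≤ (‖(Submodule.Quotient.mk r : A ⧸ Subalgebra.toSubmodule S)‖ + δ) * ‖s‖ := by gcongr
    _ ≤ _ := by linarith [mul_comm ‖s‖ ‖(Submodule.Quotient.mk r : A ⧸ Subalgebra.toSubmodule S)‖]

variable {E : Type*} [NormedAddCommGroup E] [NormedSpace ℂ E]
  {G : Type*} [TopologicalSpace G] [ChartedSpace E G] [Group G]
  [LieGroup 𝓘(ℂ, E) (minSmoothness ℂ 3) G]
  {A : Type*} [NormedRing A] [NormedAlgebra ℂ A] [FiniteDimensional ℂ A]
  {R : G →* A}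

/-- Along a segment in a chart, `r = R` satisfies `r' = r s` with `s = R⁻¹ dR` in `S`. Modulo `S`
this gives a bound of `r'` by a multiple of `r`, so Grönwall's inequality keeps the class of `r` at
its initial value zero. -/
lemma mem_of_mvfderiv_mem_aux [IsManifold 𝓘(ℂ, E) 1 G] [IsTopologicalGroup G]
    (hR : ContMDiff 𝓘(ℂ, E) 𝓘(ℂ, A) 1 R) (S : Subalgebra ℂ A)
    (hS : ∀ v : GroupLieAlgebra 𝓘(ℂ, E) G, mvfderiv 𝓘(ℂ, E) R 1 v ∈ S) (g₀ : G) (hg₀ : R g₀ ∈ S) :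
    ∀ᶠ g in 𝓝 g₀, R g ∈ S := by
  have hRd := hR.mdifferentiable one_ne_zero
  -- Left translation brings the logarithmic derivative back to the identity, where the hypothesis
  -- applies.
  have hS' (g : G) (u : TangentSpace 𝓘(ℂ, E) g) : R g⁻¹ * mvfderiv 𝓘(ℂ, E) R g u ∈ S := by
    rw [← mvfderiv_monoidHom_mul_left hRd (inv_mul_cancel g)]
    exact hS _
  set e := extChartAt 𝓘(ℂ, E) g₀
  have htar : e.target ∈ 𝓝 (e g₀) := extChartAt_target_mem_nhds g₀
  obtain ⟨ε, hε, hball⟩ := Metric.mem_nhds_iff.mp htar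
  suffices H : ∀ y ∈ Metric.ball (e g₀) ε, R (e.symm y) ∈ S by
    have h1 : ∀ᶠ g in 𝓝 g₀, e g ∈ Metric.ball (e g₀) ε :=
      (continuousAt_extChartAt (I := 𝓘(ℂ, E)) g₀).preimage_mem_nhds (Metric.ball_mem_nhds _ hε)
    filter_upwards [h1, extChartAt_source_mem_nhds (I := 𝓘(ℂ, E)) g₀] with g hg hgs
    have := H _ hg
    rwa [e.left_inv hgs] at this
  intro y₁ hy₁
  let rh : E → A := R ∘ e.symm
  have hrh : ContDiffOn ℂ 1 rh (Metric.ball (e g₀) ε) := by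
    rw [← contMDiffOn_iff_contDiffOn]
    exact hR.comp_contMDiffOn ((contMDiffOn_extChartAt_symm g₀).mono hball)
  set y₀ := e g₀
  let y : ℝ → E := fun t => y₀ + t • (y₁ - y₀)
  have hy (t : ℝ) (ht : t ∈ Icc (0 : ℝ) 1) : y t ∈ Metric.ball y₀ ε :=
    (convex_ball y₀ ε).add_smul_sub_mem (Metric.mem_ball_self hε) hy₁ ht
  have hyc : Continuous y := by fun_prop
  have hyd (t : ℝ) : HasDerivAt y (y₁ - y₀) t := by
    exact (((hasDerivAt_id t).smul_const (y₁ - y₀)).const_add y₀).congr_deriv (one_smul _ _)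
  have hopen : IsOpen (Metric.ball y₀ ε) := Metric.isOpen_ball
  have hfd (z : E) (hz : z ∈ Metric.ball y₀ ε) : HasFDerivAt rh (fderiv ℂ rh z) z :=
    ((hrh.differentiableOn one_ne_zero).differentiableAt (hopen.mem_nhds hz)).hasFDerivAt
  let d : ℝ → A := fun t => fderiv ℂ rh (y t) (y₁ - y₀)
  let s : ℝ → A := fun t => R (e.symm (y t))⁻¹ * d t
  have hsS (t : ℝ) (ht : t ∈ Icc (0 : ℝ) 1) : s t ∈ S := by
    have h1 := fderivWithin_comp_extChartAt_symm (I := 𝓘(ℂ, E)) (g := R) (hball (hy t ht)) (hRd _)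
    rw [ModelWithCorners.range_eq_univ, fderivWithin_univ] at h1
    change R (e.symm (y t))⁻¹ * fderiv ℂ (R ∘ e.symm) (y t) (y₁ - y₀) ∈ S
    rw [h1]
    exact hS' _ _
  have hds (t : ℝ) : d t = rh (y t) * s t := by
    change d t = R (e.symm (y t)) * (R (e.symm (y t))⁻¹ * d t)
    rw [← mul_assoc, ← map_mul, mul_inv_cancel, map_one, one_mul]
  have hdc : ContinuousOn d (Icc 0 1) := by
    have h1 : ContinuousOn (fun t => fderiv ℂ rh (y t)) (Icc 0 1) :=
      (hrh.continuousOn_fderiv_of_isOpen hopen le_rfl).comp hyc.continuousOn hy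
    exact h1.clm_apply continuousOn_const
  have hsc : ContinuousOn s (Icc 0 1) := by
    have h1 : ContinuousOn (fun t => e.symm (y t)) (Icc 0 1) :=
      (continuousOn_extChartAt_symm g₀).comp hyc.continuousOn fun t ht => hball (hy t ht)
    exact (hR.continuous.comp_continuousOn h1.inv).mul hdc
  obtain ⟨C, hC⟩ := isCompact_Icc.exists_bound_of_continuousOn hsc
  have hcl : IsClosed (Subalgebra.toSubmodule S : Set A) :=
    Submodule.closed_of_finiteDimensional _
  let q : A →L[ℂ] A ⧸ Subalgebra.toSubmodule S :=
    LinearMap.toContinuousLinearMap (Subalgebra.toSubmodule S).mkQ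
  have hq (a : A) : q a = Submodule.Quotient.mk a := rfl
  have hder (t : ℝ) (ht : t ∈ Icc (0 : ℝ) 1) : HasDerivAt (fun t => q (rh (y t))) (q (d t)) t :=
    ((q.hasFDerivAt.comp (y t) (hfd _ (hy t ht))).restrictScalars ℝ).comp_hasDerivAt t (hyd t)
  -- Grönwall in the quotient, with `C` a bound of `s` on the compact parameter interval.
  have h0 := eq_zero_of_abs_deriv_le_mul_abs_self_of_eq_zero_right (a := 0) (b := 1) (K := C)
    (f := fun t => q (rh (y t))) (f' := fun t => q (d t))
    (fun t ht => (hder t ht).continuousAt.continuousWithinAt)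
    (fun t ht => (hder t (Ico_subset_Icc_self ht)).hasDerivWithinAt)
    (by
      have : rh (y 0) = R g₀ := by
        simp only [y, zero_smul, add_zero, rh, Function.comp_apply]
        rw [e.left_inv (mem_extChartAt_source g₀)]
      simp only [this]
      exact (Submodule.Quotient.mk_eq_zero _).mpr hg₀)
    (fun t ht => by
      have ht' := Ico_subset_Icc_self ht
      rw [hds t]
      exact (Submodule.Quotient.norm_mk_mul_le S _ (hsS t ht')).trans
        (mul_le_mul_of_nonneg_right (hC t ht') (norm_nonneg _)))
    1 (by simp)
  have h1 : y 1 = y₁ := by simp [y]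
  simp only [h1] at h0
  exact (Submodule.Quotient.mk_eq_zero _).mp h0

/-- A smooth homomorphism from a connected Lie group to the unit group of a finite-dimensional
algebra takes values in every subalgebra that contains the image of its differential. -/
lemma mem_of_mvfderiv_mem [ConnectedSpace G]
    (hR : ContMDiff 𝓘(ℂ, E) 𝓘(ℂ, A) 1 R) (S : Subalgebra ℂ A)
    (hS : ∀ v : GroupLieAlgebra 𝓘(ℂ, E) G, mvfderiv 𝓘(ℂ, E) R 1 v ∈ S) (g : G) : R g ∈ S := by
  have : IsManifold 𝓘(ℂ, E) 1 G := IsManifold.of_le (n := minSmoothness ℂ 3)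
    (le_trans (by norm_cast) le_minSmoothness)
  have : IsTopologicalGroup G := topologicalGroup_of_lieGroup 𝓘(ℂ, E) (minSmoothness ℂ 3)
  have hclosed : IsClosed {g | R g ∈ S} :=
    (Submodule.closed_of_finiteDimensional (Subalgebra.toSubmodule S)).preimage hR.continuous
  have hop : IsOpen {g | R g ∈ S} := isOpen_iff_eventually.mpr fun g₀ hg₀ =>
    mem_of_mvfderiv_mem_aux hR S hS g₀ hg₀
  have huniv : {g | R g ∈ S} = univ :=
    IsClopen.eq_univ ⟨hclosed, hop⟩ ⟨1, by simp [S.one_mem]⟩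
  exact eq_univ_iff_forall.mp huniv g

/-- The differential of a smooth homomorphism takes values in every subspace that contains the
image of the homomorphism. -/
lemma mvfderiv_mem {M F : Type*} [TopologicalSpace M] [ChartedSpace E M] [NormedAddCommGroup F]
    [NormedSpace ℂ F] [FiniteDimensional ℂ F] {R : M → F} {x : M}
    (hR : MDifferentiableAt 𝓘(ℂ, E) 𝓘(ℂ, F) R x) (S : Submodule ℂ F) (hS : ∀ y, R y ∈ S)
    (v : TangentSpace 𝓘(ℂ, E) x) : mvfderiv 𝓘(ℂ, E) R x v ∈ S := by
  have hcl : IsClosed (S : Set F) := Submodule.closed_of_finiteDimensional _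
  let q : F →L[ℂ] F ⧸ S := LinearMap.toContinuousLinearMap S.mkQ
  have h1 : q ∘ R = fun _ => 0 := by
    ext y
    exact (Submodule.Quotient.mk_eq_zero _).mpr (hS y)
  have h2 := mvfderiv_clm_comp q hR
  rw [h1, mvfderiv_const] at h2
  exact (Submodule.Quotient.mk_eq_zero S).mp (DFunLike.congr_fun h2 v).symm

end Invariance

/-! ### Complete reducibility for connected semisimple complex Lie groups. -/

section CompleteReducibility

variable {d : ℕ} {G : Type*} [Group G] [TopologicalSpace G]
  [ChartedSpace (EuclideanSpace ℂ (Fin d)) G]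
  {X : Type*} [AddCommGroup X] [Module ℂ X] [FiniteDimensional ℂ X]

/-- `X` carries no norm, so its endomorphism algebra is transported to that of $\mathbb C^n$; there
the representation is a combination of constant matrices with its matrix coefficients as
coefficients. -/
lemma SuperMF.IsHolomorphic.exists_contMDiff {ρ : Representation ℂ G X}
    (hρ : SuperMF.IsHolomorphic d ρ) :
    ∃ Θ : Module.End ℂ X ≃ₐ[ℂ]
        ((Fin (Module.finrank ℂ X) → ℂ) →L[ℂ] (Fin (Module.finrank ℂ X) → ℂ)),
      ContMDiff 𝓘(ℂ, EuclideanSpace ℂ (Fin d))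
        𝓘(ℂ, (Fin (Module.finrank ℂ X) → ℂ) →L[ℂ] (Fin (Module.finrank ℂ X) → ℂ)) ω
        (fun g => Θ (ρ g)) := by
  let b := Module.finBasis ℂ X
  refine ⟨(b.equivFun.conjAlgEquiv ℂ).trans (Module.End.toContinuousLinearMap _), ?_⟩
  set Θ := (b.equivFun.conjAlgEquiv ℂ).trans (Module.End.toContinuousLinearMap _)
  have h (T : Module.End ℂ X) : Θ T =
      ∑ i, ∑ j, b.coord i (T (b j)) • Θ (LinearMap.toMatrix b b |>.symm (Matrix.single i j 1)) := by
    have h1 : T = ∑ i, ∑ j, b.coord i (T (b j)) •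
        (LinearMap.toMatrix b b |>.symm (Matrix.single i j 1)) := by
      apply (LinearMap.toMatrix b b).injective
      conv_lhs => rw [Matrix.matrix_eq_sum_single (LinearMap.toMatrix b b T)]
      simp only [map_sum, map_smul, LinearEquiv.apply_symm_apply, Matrix.smul_single]
      simp [LinearMap.toMatrix_apply]
    conv_lhs => rw [h1]
    simp only [map_sum, map_smul]
  have h2 : (fun g => Θ (ρ g)) = fun g => ∑ i, ∑ j, b.coord i (ρ g (b j)) •
      Θ (LinearMap.toMatrix b b |>.symm (Matrix.single i j 1)) := funext fun g => h (ρ g)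
  rw [h2]
  refine contMDiff_finsetSum fun i _ => contMDiff_finsetSum fun j _ => ?_
  exact (hρ (b j) (b.coord i)).smul contMDiff_const

variable [LieGroup 𝓘(ℂ, EuclideanSpace ℂ (Fin d)) ω G] [ConnectedSpace G]
    [LieAlgebra.HasTrivialRadical ℂ (GroupLieAlgebra 𝓘(ℂ, EuclideanSpace ℂ (Fin d)) G)]

/-- Complete reducibility of the holomorphic finite-dimensional representations of a connected
complex Lie group with semisimple Lie algebra. -/
theorem SuperMF.IsHolomorphic.isSemisimpleRepresentation {ρ : Representation ℂ G X}
    (hρ : SuperMF.IsHolomorphic d ρ) : ρ.IsSemisimpleRepresentation := by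
  obtain ⟨Θ, hΘ⟩ := hρ.exists_contMDiff
  set A := (Fin (Module.finrank ℂ X) → ℂ) →L[ℂ] (Fin (Module.finrank ℂ X) → ℂ)
  let R : G →* A := (Θ : Module.End ℂ X →* A).comp ρ
  have hR : ContMDiff 𝓘(ℂ, EuclideanSpace ℂ (Fin d)) 𝓘(ℂ, A) ω R := hΘ
  have hR3 : ContMDiff 𝓘(ℂ, EuclideanSpace ℂ (Fin d)) 𝓘(ℂ, A) (minSmoothness ℂ 3) R :=
    hR.of_le le_top
  have hRd : MDifferentiable 𝓘(ℂ, EuclideanSpace ℂ (Fin d)) 𝓘(ℂ, A) R :=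
    hR.mdifferentiable (by simp)
  let L := GroupLieAlgebra 𝓘(ℂ, EuclideanSpace ℂ (Fin d)) G
  -- The differentiated representation, which makes `X` a Lie module.
  let D : L →ₗ[ℂ] Module.End ℂ X := Θ.symm.toLinearMap ∘ₗ
    (mvfderiv 𝓘(ℂ, EuclideanSpace ℂ (Fin d)) R 1 : L →ₗ[ℂ] A)
  have hD (v : L) : Θ (D v) = mvfderiv 𝓘(ℂ, EuclideanSpace ℂ (Fin d)) R 1 v :=
    Θ.apply_symm_apply _
  have hDlie (v w : L) : D ⁅v, w⁆ = D v * D w - D w * D v := by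
    apply Θ.injective
    rw [map_sub, map_mul, map_mul, hD, hD, hD]
    exact mvfderiv_monoidHom_lie hR3 v w
  let _ : LieRingModule L X :=
    { bracket := fun v x => D v x
      add_lie := fun v w x => by simp
      lie_add := fun v x y => by simp
      leibniz_lie := fun v w x => by
        change D v (D w x) = D ⁅v, w⁆ x + D w (D v x)
        rw [hDlie]
        simp }
  let _ : LieModule ℂ L X :=
    { smul_lie := fun c v x => by
        change D (c • v) x = c • D v x
        simp
      lie_smul := fun c v x => by
        change D v (c • x) = c • D v x
        simp }
  have : FiniteDimensional ℂ L := inferInstanceAs (FiniteDimensional ℂ (EuclideanSpace ℂ (Fin d)))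
  -- Stability of `N` means having values in this subalgebra. The differential of `R` inherits this
  -- from `R`, and conversely `R` inherits it from its differential by connectedness; so the
  -- complement found for the Lie algebra is one for the group.
  let stab (N : Submodule ℂ X) : Subalgebra ℂ (Module.End ℂ X) :=
    { carrier := {T | ∀ x ∈ N, T x ∈ N}
      mul_mem' := fun {a b} ha hb x hx => ha _ (hb x hx)
      add_mem' := fun {a b} ha hb x hx => N.add_mem (ha x hx) (hb x hx)
      algebraMap_mem' := fun c x hx => N.smul_mem c hx }
  refine ⟨fun N => ?_⟩
  let NL : LieSubmodule ℂ L X :=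
    { N.toSubmodule with
      lie_mem := fun {v x} hx => by
        have h1 := mvfderiv_mem (hRd 1)
          (Subalgebra.toSubmodule ((stab N.toSubmodule).map (Θ : Module.End ℂ X →ₐ[ℂ] A)))
          (fun g => ⟨ρ g, fun x hx => N.apply_mem_toSubmodule g hx, rfl⟩) v
        obtain ⟨T, hT, hT'⟩ := h1
        have h2 : T = D v := Θ.injective (hT'.trans (hD v).symm)
        exact (h2 ▸ hT) x hx }
  obtain ⟨N', hN'⟩ := NL.exists_isCompl_of_hasTrivialRadical
  let N'' : Subrepresentation ρ :=
    { toSubmodule := N'.toSubmodule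
      apply_mem_toSubmodule := fun g x hx => by
        have h1 := mem_of_mvfderiv_mem (hR.of_le le_top)
          ((stab N'.toSubmodule).map (Θ : Module.End ℂ X →ₐ[ℂ] A))
          (fun v => ⟨D v, fun x hx => N'.lie_mem hx, hD v⟩) g
        obtain ⟨T, hT, hT'⟩ := h1
        have h2 : T = ρ g := Θ.injective hT'
        exact (h2 ▸ hT) x hx }
  refine ⟨N'', ?_⟩
  rw [isCompl_iff, disjoint_iff, codisjoint_iff] at hN' ⊢
  exact ⟨Subrepresentation.toSubmodule_injective hN'.1,
    Subrepresentation.toSubmodule_injective hN'.2⟩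

end CompleteReducibility

noncomputable section

namespace SuperMF

/-! ### Vector-valued functions with holomorphic coefficients. -/

section HolomorphicFunctions

variable {d : ℕ} {G : Type*} [TopologicalSpace G] [ChartedSpace (EuclideanSpace ℂ (Fin d)) G]
  {A B C : Type*} [AddCommGroup A] [Module ℂ A] [AddCommGroup B] [Module ℂ B]
  [AddCommGroup C] [Module ℂ C]

variable (d G A) in
/-- The functions `G → A` of the form `g ↦ ∑ hₖ(g) aₖ` with holomorphic coefficients `hₖ`. -/
def holSpan : Submodule ℂ (G → A) :=
  Submodule.span ℂ {f | ∃ h : G → ℂ, ContMDiff 𝓘(ℂ, EuclideanSpace ℂ (Fin d)) 𝓘(ℂ, ℂ) ω h ∧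
    ∃ a : A, f = fun g => h g • a}

lemma smul_mem_holSpan {h : G → ℂ}
    (hh : ContMDiff 𝓘(ℂ, EuclideanSpace ℂ (Fin d)) 𝓘(ℂ, ℂ) ω h) (a : A) :
    (fun g => h g • a) ∈ holSpan d G A :=
  Submodule.subset_span ⟨h, hh, a, rfl⟩

lemma const_mem_holSpan (a : A) : (fun _ => a) ∈ holSpan d G A := by
  simpa using smul_mem_holSpan (d := d) (G := G) (h := fun _ => 1) contMDiff_const a

/-- Products of coefficient functions are holomorphic. Stability under bilinear maps carries
holomorphy from the generators of $P(V)$ to all products, although $P(V)$ may be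
infinite-dimensional. -/
lemma bilin_mem_holSpan (β : A →ₗ[ℂ] B →ₗ[ℂ] C) {f : G → A} {f' : G → B}
    (hf : f ∈ holSpan d G A) (hf' : f' ∈ holSpan d G B) :
    (fun g => β (f g) (f' g)) ∈ holSpan d G C := by
  induction hf, hf' using Submodule.span_induction₂ with
  | mem_mem x y hx hy =>
    obtain ⟨h, hh, a, rfl⟩ := hx
    obtain ⟨h', hh', a', rfl⟩ := hy
    have := smul_mem_holSpan (hh'.mul hh) (β a a')
    simp only [map_smul, LinearMap.smul_apply, smul_smul]
    exact this
  | zero_left y hy =>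
    simp only [Pi.zero_apply, map_zero, LinearMap.zero_apply]
    exact (holSpan d G C).zero_mem
  | zero_right x hx =>
    simp only [Pi.zero_apply, map_zero]
    exact (holSpan d G C).zero_mem
  | add_left x y z _ _ _ h1 h2 =>
    simp only [Pi.add_apply, map_add, LinearMap.add_apply]
    exact (holSpan d G C).add_mem h1 h2
  | add_right x y z _ _ _ h1 h2 =>
    simp only [Pi.add_apply, map_add]
    exact (holSpan d G C).add_mem h1 h2
  | smul_left c x y _ _ h1 =>
    simp only [Pi.smul_apply, map_smul, LinearMap.smul_apply]
    exact (holSpan d G C).smul_mem c h1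
  | smul_right c x y _ _ h1 =>
    simp only [Pi.smul_apply, map_smul]
    exact (holSpan d G C).smul_mem c h1

lemma linear_mem_holSpan (T : A →ₗ[ℂ] B) {f : G → A} (hf : f ∈ holSpan d G A) :
    (fun g => T (f g)) ∈ holSpan d G B := by
  simpa using bilin_mem_holSpan ((LinearMap.lsmul ℂ B).flip ∘ₗ T) hf (const_mem_holSpan (1 : ℂ))

lemma contMDiff_of_mem_holSpan {f : G → ℂ} (hf : f ∈ holSpan d G ℂ) :
    ContMDiff 𝓘(ℂ, EuclideanSpace ℂ (Fin d)) 𝓘(ℂ, ℂ) ω f := by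
  induction hf using Submodule.span_induction with
  | mem x hx =>
    obtain ⟨h, hh, a, rfl⟩ := hx
    exact hh.mul contMDiff_const
  | zero => exact contMDiff_const
  | add x y _ _ h1 h2 => exact h1.add h2
  | smul c x _ h1 => exact contMDiff_const.mul h1

end HolomorphicFunctions

/-! ### Holomorphy of the representation on $P(V)$, of subrepresentations and of quotients. -/

section HolomorphicReps

variable {d : ℕ} {G : Type*} [Group G] [TopologicalSpace G]
  [ChartedSpace (EuclideanSpace ℂ (Fin d)) G]
  {X : Type*} [AddCommGroup X] [Module ℂ X]

lemma isHolomorphic_of_mem_holSpan {ρ : Representation ℂ G X}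
    (h : ∀ x, (fun g => ρ g x) ∈ holSpan d G X) : IsHolomorphic d ρ :=
  fun x φ => contMDiff_of_mem_holSpan (linear_mem_holSpan φ (h x))

lemma IsHolomorphic.mem_holSpan [FiniteDimensional ℂ X] {ρ : Representation ℂ G X}
    (hρ : IsHolomorphic d ρ) (x : X) : (fun g => ρ g x) ∈ holSpan d G X := by
  let b := Module.finBasis ℂ X
  have h : (fun g => ρ g x) = ∑ i, fun g => b.coord i (ρ g x) • b i := by
    ext g
    rw [Finset.sum_apply]
    exact (b.sum_repr (ρ g x)).symm
  rw [h]
  exact Submodule.sum_mem _ fun i _ => smul_mem_holSpan (hρ x (b.coord i)) (b i)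

lemma IsHolomorphic.toRepresentation {ρ : Representation ℂ G X} (hρ : IsHolomorphic d ρ)
    (N : Subrepresentation ρ) : IsHolomorphic d N.toRepresentation := by
  intro x φ
  obtain ⟨Φ, hΦ⟩ := φ.exists_extend
  refine (hρ x Φ).congr fun g => ?_
  exact (LinearMap.congr_fun hΦ (N.toRepresentation g x)).symm

lemma IsHolomorphic.of_surjective {Y : Type*} [AddCommGroup Y] [Module ℂ Y]
    {ρ : Representation ℂ G X} {σ : Representation ℂ G Y}
    (hρ : IsHolomorphic d ρ) (f : ρ.IntertwiningMap σ) (hf : Function.Surjective f) :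
    IsHolomorphic d σ := by
  intro y φ
  obtain ⟨x, rfl⟩ := hf y
  refine (hρ x (φ ∘ₗ f.toLinearMap)).congr fun g => ?_
  rw [← f.isIntertwining]
  rfl

variable {V₀ V₁ : Type*} [AddCommGroup V₀] [Module ℂ V₀] [FiniteDimensional ℂ V₀]
  [AddCommGroup V₁] [Module ℂ V₁] [FiniteDimensional ℂ V₁]
  {ρ₀ : Representation ℂ G V₀} {ρ₁ : Representation ℂ G V₁}

lemma IsHolomorphic.symRep_mem_holSpan (hρ : IsHolomorphic d ρ₀) (x : SymmetricAlgebra ℂ V₀) :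
    (fun g => symRep ρ₀ g x) ∈ holSpan d G (SymmetricAlgebra ℂ V₀) := by
  have e (g : G) (x) : symRep ρ₀ g x = symMap (ρ₀ g) x := rfl
  simp only [e]
  induction x using SymmetricAlgebra.induction with
  | algebraMap r => simpa using const_mem_holSpan _
  | ι v => simpa using linear_mem_holSpan (SymmetricAlgebra.ι ℂ V₀) (hρ.mem_holSpan v)
  | mul a b ha hb => simpa using bilin_mem_holSpan (LinearMap.mul ℂ _) ha hb
  | add a b ha hb =>
    simp only [map_add]
    exact (holSpan d G _).add_mem ha hb

lemma IsHolomorphic.extRep_mem_holSpan (hρ : IsHolomorphic d ρ₁) (x : ExteriorAlgebra ℂ V₁) :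
    (fun g => extRep ρ₁ g x) ∈ holSpan d G (ExteriorAlgebra ℂ V₁) := by
  have e (g : G) (x) : extRep ρ₁ g x = ExteriorAlgebra.map (ρ₁ g) x := rfl
  simp only [e]
  induction x using ExteriorAlgebra.induction with
  | algebraMap r => simpa using const_mem_holSpan _
  | ι v => simpa using linear_mem_holSpan (ExteriorAlgebra.ι ℂ) (hρ.mem_holSpan v)
  | mul a b ha hb => simpa using bilin_mem_holSpan (LinearMap.mul ℂ _) ha hb
  | add a b ha hb =>
    simp only [map_add]
    exact (holSpan d G _).add_mem ha hb

lemma IsHolomorphic.superSymRep (hρ₀ : IsHolomorphic d ρ₀) (hρ₁ : IsHolomorphic d ρ₁) :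
    IsHolomorphic d (superSymRep ρ₀ ρ₁) := by
  refine isHolomorphic_of_mem_holSpan fun x => ?_
  induction x using TensorProduct.induction_on with
  | zero =>
    simp only [map_zero]
    exact (holSpan d G (SuperSym V₀ V₁)).zero_mem
  | tmul a b =>
    exact bilin_mem_holSpan
      (TensorProduct.mk ℂ (SymmetricAlgebra ℂ V₀) (ExteriorAlgebra ℂ V₁))
      (hρ₀.symRep_mem_holSpan a) (hρ₁.extRep_mem_holSpan b)
  | add a b ha hb =>
    simp only [map_add]
    exact (holSpan d G _).add_mem ha hb

end HolomorphicReps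

end SuperMF

end

noncomputable section

namespace SuperMF

/-! ### Ordered products of powers of subspaces in an algebra. -/

section MultiPowers

variable {A : Type*} [Ring A] [Algebra ℂ A]

/-- The product `N₁^{i₁} ⋯ N_k^{i_k}` of powers of subspaces of an algebra. -/
def multiPow {k : ℕ} (N : Fin k → Submodule ℂ A) (i : Fin k → ℕ) : Submodule ℂ A :=
  (List.ofFn fun p => N p ^ i p).prod

lemma multiPow_succ {k : ℕ} (N : Fin (k + 1) → Submodule ℂ A) (i : Fin (k + 1) → ℕ) :
    multiPow N i = N 0 ^ i 0 * multiPow (fun p => N p.succ) (fun p => i p.succ) := by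
  simp [multiPow, List.ofFn_succ]

lemma multiPow_zero_right {k : ℕ} (N : Fin k → Submodule ℂ A) : multiPow N 0 = 1 := by
  simp [multiPow]

lemma mul_le_eigenspace (F : A →ₐ[ℂ] A) {M N : Submodule ℂ A} {a b : ℂ}
    (hM : M ≤ Module.End.eigenspace F.toLinearMap a)
    (hN : N ≤ Module.End.eigenspace F.toLinearMap b) :
    M * N ≤ Module.End.eigenspace F.toLinearMap (a * b) := by
  rw [Submodule.mul_le]
  intro x hx y hy
  have h1 := Module.End.mem_eigenspace_iff.mp (hM hx)
  have h2 := Module.End.mem_eigenspace_iff.mp (hN hy)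
  rw [AlgHom.toLinearMap_apply] at h1 h2
  rw [Module.End.mem_eigenspace_iff, AlgHom.toLinearMap_apply, map_mul, h1, h2, smul_mul_smul_comm]

lemma pow_le_eigenspace (F : A →ₐ[ℂ] A) {M : Submodule ℂ A} {a : ℂ}
    (hM : M ≤ Module.End.eigenspace F.toLinearMap a) (n : ℕ) :
    M ^ n ≤ Module.End.eigenspace F.toLinearMap (a ^ n) := by
  induction n with
  | zero => simp
  | succ n ih => rw [pow_succ, pow_succ]; exact mul_le_eigenspace F ih hM

lemma multiPow_le_eigenspace (F : A →ₐ[ℂ] A) {k : ℕ} {N : Fin k → Submodule ℂ A} {c : Fin k → ℂ}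
    (hN : ∀ p, N p ≤ Module.End.eigenspace F.toLinearMap (c p)) (i : Fin k → ℕ) :
    multiPow N i ≤ Module.End.eigenspace F.toLinearMap (∏ p, c p ^ i p) := by
  induction k with
  | zero => simp [multiPow]
  | succ k ih =>
    rw [multiPow_succ, Fin.prod_univ_succ]
    exact mul_le_eigenspace F (pow_le_eigenspace F (hN 0) _) (ih (fun p => hN p.succ) _)

lemma multiPow_le_pow {k : ℕ} {N : Fin k → Submodule ℂ A} {R : Submodule ℂ A}
    (hN : ∀ p, N p ≤ R) (i : Fin k → ℕ) : multiPow N i ≤ R ^ ∑ p, i p := by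
  induction k with
  | zero => simp [multiPow]
  | succ k ih =>
    rw [multiPow_succ, Fin.sum_univ_succ, pow_add]
    exact mul_le_mul' (pow_le_pow_left' (hN 0) _) (ih (fun p => hN p.succ) _)

lemma multiPow_fg {k : ℕ} {N : Fin k → Submodule ℂ A} (hN : ∀ p, (N p).FG) (i : Fin k → ℕ) :
    (multiPow N i).FG := by
  induction k with
  | zero =>
    have : multiPow N i = 1 := by simp [multiPow]
    rw [this, Submodule.one_eq_span]
    exact Submodule.fg_span_singleton 1
  | succ k ih =>
    rw [multiPow_succ]
    exact ((hN 0).pow _).mul (ih (fun p => hN p.succ) _)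

/-- Only the subspaces need to commute, not their elements; this allows `N q` to pass the earlier
factors in the exterior algebra too. -/
lemma mul_multiPow {k : ℕ} {N : Fin k → Submodule ℂ A} (hN : ∀ p q, Commute (N p) (N q))
    (i : Fin k → ℕ) (q : Fin k) : N q * multiPow N i = multiPow N (i + Pi.single q 1) := by
  induction k with
  | zero => exact q.elim0
  | succ k ih =>
    rw [multiPow_succ, multiPow_succ]
    cases q using Fin.cases with
    | zero =>
      have : (fun p : Fin k => (i + Pi.single 0 1 : Fin (k + 1) → ℕ) p.succ) =
          fun p => i p.succ := by
        ext p; simp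
      rw [this, ← mul_assoc, ← pow_succ']
      simp
    | succ q =>
      have : (fun p : Fin k => (i + Pi.single q.succ 1 : Fin (k + 1) → ℕ) p.succ) =
          (fun p => i p.succ) + Pi.single q 1 := by
        ext p; simp [Pi.single_apply]
      rw [this, ← ih (fun p q => hN p.succ q.succ), ← mul_assoc, ← mul_assoc,
        ((hN q.succ 0).pow_right _).eq]
      simp

/-- The sum of all multipowers contains `1` and is stable under left multiplication by generators,
hence by the whole algebra. -/
lemma iSup_multiPow_eq_top {V : Type*} [AddCommGroup V] [Module ℂ V] {k : ℕ} (f : V →ₗ[ℂ] A)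
    (hgen : Algebra.adjoin ℂ (Set.range f) = ⊤) {U : Fin k → Submodule ℂ V} (hU : ⨆ p, U p = ⊤)
    (hN : ∀ p q, Commute ((U p).map f) ((U q).map f)) :
    ⨆ i, multiPow (fun p => (U p).map f) i = ⊤ := by
  set S := ⨆ i, multiPow (fun p => (U p).map f) i
  have hmul (v : V) (s : A) (hs : s ∈ S) : f v * s ∈ S := by
    have h1 : (⨆ q, (U q).map f) * S ≤ S := by
      rw [Submodule.iSup_mul]
      refine iSup_le fun q => ?_
      rw [Submodule.mul_iSup]
      refine iSup_le fun i => ?_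
      rw [mul_multiPow hN]
      exact le_iSup (fun i => multiPow (fun p => (U p).map f) i) _
    refine h1 (Submodule.mul_mem_mul ?_ hs)
    rw [← Submodule.map_iSup, hU]
    exact ⟨v, trivial, rfl⟩
  have hone : (1 : A) ∈ S :=
    (le_iSup (fun i => multiPow (fun p => (U p).map f) i) 0)
      (multiPow_zero_right (fun p => (U p).map f) ▸ Submodule.one_le.mp le_rfl)
  rw [eq_top_iff]
  rintro x -
  have hx : ∀ s ∈ S, x * s ∈ S := by
    have hx' : x ∈ Algebra.adjoin ℂ (Set.range f) := hgen ▸ Algebra.mem_top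
    induction hx' using Algebra.adjoin_induction with
    | mem x hx => obtain ⟨v, rfl⟩ := hx; exact hmul v
    | algebraMap r => intro s hs; rw [← Algebra.smul_def]; exact S.smul_mem r hs
    | add x y _ _ hx hy => intro s hs; rw [add_mul]; exact S.add_mem (hx s hs) (hy s hs)
    | mul x y _ _ hx hy => intro s hs; rw [mul_assoc]; exact hx _ (hy s hs)
  simpa using hx 1 hone

end MultiPowers

/-! ### The components span $P(V)$ and are finite-dimensional. -/

section Components

variable {V₀ V₁ : Type*} [AddCommGroup V₀] [Module ℂ V₀] [AddCommGroup V₁] [Module ℂ V₁]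
  {k l : ℕ} (U : Fin k → Submodule ℂ V₀) (W : Fin l → Submodule ℂ V₁)

lemma component_eq (i : Fin k → ℕ) (j : Fin l → ℕ) :
    component U W i j =
      Submodule.map₂ (TensorProduct.mk ℂ (SymmetricAlgebra ℂ V₀) (ExteriorAlgebra ℂ V₁))
        (multiPow (fun p => (U p).map (SymmetricAlgebra.ι ℂ V₀)) i)
        (multiPow (fun q => (W q).map (ExteriorAlgebra.ι ℂ)) j) := by
  rw [component, multiPow, multiPow, List.prod_ofFn]

lemma component_fg [FiniteDimensional ℂ V₀] [FiniteDimensional ℂ V₁] (i : Fin k → ℕ)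
    (j : Fin l → ℕ) : (component U W i j).FG := by
  rw [component_eq]
  exact (multiPow_fg (fun p => (IsNoetherian.noetherian (U p)).map _) _).map₂ _
    (multiPow_fg (fun q => (IsNoetherian.noetherian (W q)).map _) _)

variable (V₀ V₁) in
/-- The part of `P(V)` that is homogeneous of degree `m` in the even and of degree `n` in the odd
variables. -/
def bidegree (m n : ℕ) : Submodule ℂ (SuperSym V₀ V₁) :=
  Submodule.map₂ (TensorProduct.mk ℂ (SymmetricAlgebra ℂ V₀) (ExteriorAlgebra ℂ V₁))
    (LinearMap.range (SymmetricAlgebra.ι ℂ V₀) ^ m) (LinearMap.range (ExteriorAlgebra.ι ℂ) ^ n)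

lemma component_le_bidegree (i : Fin k → ℕ) (j : Fin l → ℕ) :
    component U W i j ≤ bidegree V₀ V₁ (∑ p, i p) (∑ q, j q) := by
  rw [component_eq]
  exact Submodule.map₂_le_map₂ (multiPow_le_pow (fun p => LinearMap.map_le_range) _)
    (multiPow_le_pow (fun p => LinearMap.map_le_range) _)

lemma symmetricAlgebra_adjoin_range_ι :
    Algebra.adjoin ℂ (Set.range (SymmetricAlgebra.ι ℂ V₀)) = ⊤ := by
  rw [eq_top_iff]
  rintro x -
  induction x using SymmetricAlgebra.induction with
  | algebraMap r => exact Subalgebra.algebraMap_mem _ r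
  | ι v => exact Algebra.subset_adjoin ⟨v, rfl⟩
  | mul a b ha hb => exact Subalgebra.mul_mem _ ha hb
  | add a b ha hb => exact Subalgebra.add_mem _ ha hb

lemma exteriorAlgebra_adjoin_range_ι :
    Algebra.adjoin ℂ (Set.range (ExteriorAlgebra.ι ℂ : V₁ →ₗ[ℂ] ExteriorAlgebra ℂ V₁)) = ⊤ := by
  rw [eq_top_iff]
  rintro x -
  induction x using ExteriorAlgebra.induction with
  | algebraMap r => exact Subalgebra.algebraMap_mem _ r
  | ι v => exact Algebra.subset_adjoin ⟨v, rfl⟩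
  | mul a b ha hb => exact Subalgebra.mul_mem _ ha hb
  | add a b ha hb => exact Subalgebra.add_mem _ ha hb

/-- Vectors anticommute, and a subspace absorbs the sign. -/
lemma commute_map_exteriorAlgebra_ι (M N : Submodule ℂ V₁) :
    Commute (M.map (ExteriorAlgebra.ι ℂ)) (N.map (ExteriorAlgebra.ι ℂ)) := by
  have h (M N : Submodule ℂ V₁) : M.map (ExteriorAlgebra.ι ℂ) * N.map (ExteriorAlgebra.ι ℂ) ≤
      N.map (ExteriorAlgebra.ι ℂ) * M.map (ExteriorAlgebra.ι ℂ) := by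
    rw [Submodule.mul_le]
    rintro _ ⟨x, hx, rfl⟩ _ ⟨y, hy, rfl⟩
    rw [eq_neg_of_add_eq_zero_left (ExteriorAlgebra.ι_add_mul_swap x y)]
    exact Submodule.neg_mem _ (Submodule.mul_mem_mul ⟨y, hy, rfl⟩ ⟨x, hx, rfl⟩)
  exact le_antisymm (h M N) (h N M)

variable {U W} in
lemma iSup_component (hU : ⨆ p, U p = ⊤) (hW : ⨆ q, W q = ⊤) :
    ⨆ ij : (Fin k → ℕ) × (Fin l → ℕ), component U W ij.1 ij.2 = ⊤ := by
  have h0 := iSup_multiPow_eq_top (SymmetricAlgebra.ι ℂ V₀) symmetricAlgebra_adjoin_range_ι hU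
    (fun p q => Commute.all _ _)
  have h1 := iSup_multiPow_eq_top (ExteriorAlgebra.ι ℂ) exteriorAlgebra_adjoin_range_ι hW
    (fun p q => commute_map_exteriorAlgebra_ι _ _)
  simp only [component_eq]
  rw [iSup_prod, ← TensorProduct.map₂_mk_top_top_eq_top, ← h0, ← h1, Submodule.map₂_iSup_left]
  simp only [Submodule.map₂_iSup_right]

end Components

/-! ### The components as weight spaces of the torus. -/

section Saturated

variable {H : Type*} [Group H]
variable {V₀ V₁ : Type*} [AddCommGroup V₀] [Module ℂ V₀] [AddCommGroup V₁] [Module ℂ V₁]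

lemma superSymRep_tmul (ρ₀ : Representation ℂ H V₀) (ρ₁ : Representation ℂ H V₁) (h : H)
    (a : SymmetricAlgebra ℂ V₀) (b : ExteriorAlgebra ℂ V₁) :
    superSymRep ρ₀ ρ₁ h (a ⊗ₜ b) = symMap (ρ₀ h) a ⊗ₜ ExteriorAlgebra.map (ρ₁ h) b := rfl

lemma superSymRep_congr {H' : Type*} [Group H'] {ρ₀ : Representation ℂ H V₀}
    {ρ₁ : Representation ℂ H V₁} {σ₀ : Representation ℂ H' V₀} {σ₁ : Representation ℂ H' V₁}
    {h : H} {h' : H'} (h0 : ρ₀ h = σ₀ h') (h1 : ρ₁ h = σ₁ h') :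
    superSymRep ρ₀ ρ₁ h = superSymRep σ₀ σ₁ h' := by
  refine TensorProduct.ext' fun a b => ?_
  rw [superSymRep_tmul, superSymRep_tmul, h0, h1]

variable {G : Type*} [Group G] {ρ₀ : Representation ℂ G V₀} {ρ₁ : Representation ℂ G V₁} {k l : ℕ}
  {U : Fin k → Subrepresentation ρ₀} {W : Fin l → Subrepresentation ρ₁}
  (hU : DirectSum.IsInternal fun p => (U p).toSubmodule)
  (hW : DirectSum.IsInternal fun q => (W q).toSubmodule)

lemma saturatedEven_apply (t : Fin k ⊕ Fin l → ℂˣ) (g : G) {p : Fin k} {x : V₀}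
    (hx : x ∈ (U p).toSubmodule) :
    saturatedEven l U hU (t, g) x = (t (Sum.inl p) : ℂ) • ρ₀ g x :=
  scaledRep_apply U hU _ g p x hx

lemma saturatedOdd_apply (t : Fin k ⊕ Fin l → ℂˣ) (g : G) {q : Fin l} {x : V₁}
    (hx : x ∈ (W q).toSubmodule) :
    saturatedOdd k W hW (t, g) x = (t (Sum.inr q) : ℂ) • ρ₁ g x :=
  scaledRep_apply W hW _ g q x hx

lemma saturatedEven_one (g : G) :
    saturatedEven l U hU ((1 : Fin k ⊕ Fin l → ℂˣ), g) = ρ₀ g := by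
  refine LinearMap.ext_on_range (v := fun x : Σ p, (U p).toSubmodule => (x.2 : V₀)) ?_ ?_
  · rw [eq_top_iff, ← hU.submodule_iSup_eq_top]
    exact iSup_le fun p x hx => Submodule.subset_span ⟨⟨p, x, hx⟩, rfl⟩
  · rintro ⟨p, x, hx⟩
    simp [saturatedEven_apply hU _ _ hx]

lemma saturatedOdd_one (g : G) :
    saturatedOdd k W hW ((1 : Fin k ⊕ Fin l → ℂˣ), g) = ρ₁ g := by
  refine LinearMap.ext_on_range (v := fun x : Σ q, (W q).toSubmodule => (x.2 : V₁)) ?_ ?_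
  · rw [eq_top_iff, ← hW.submodule_iSup_eq_top]
    exact iSup_le fun p x hx => Submodule.subset_span ⟨⟨p, x, hx⟩, rfl⟩
  · rintro ⟨p, x, hx⟩
    simp [saturatedOdd_apply hW _ _ hx]

/-- The representation of the saturated group on `P(V)`. -/
abbrev saturatedRep : Representation ℂ (Saturated k l G) (SuperSym V₀ V₁) :=
  superSymRep (saturatedEven l U hU) (saturatedOdd k W hW)

/-- The character by which the torus `(ℂˣ)^(k+l)` acts on the component of index `(i, j)`. -/
def torusChar (t : Fin k ⊕ Fin l → ℂˣ) (ij : (Fin k → ℕ) × (Fin l → ℕ)) : ℂ :=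
  (∏ p, (t (Sum.inl p) : ℂ) ^ ij.1 p) * ∏ q, (t (Sum.inr q) : ℂ) ^ ij.2 q

/-- The component of index `(i, j)` of `P(V)`, as a subspace. -/
abbrev componentSub (U : Fin k → Subrepresentation ρ₀) (W : Fin l → Subrepresentation ρ₁)
    (ij : (Fin k → ℕ) × (Fin l → ℕ)) : Submodule ℂ (SuperSym V₀ V₁) :=
  component (fun p => (U p).toSubmodule) (fun q => (W q).toSubmodule) ij.1 ij.2

lemma componentSub_le_eigenspace (t : Fin k ⊕ Fin l → ℂˣ) (ij : (Fin k → ℕ) × (Fin l → ℕ)) :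
    componentSub U W ij ≤
      Module.End.eigenspace (saturatedRep hU hW (t, 1)) (torusChar t ij) := by
  rw [componentSub, component_eq, Submodule.map₂_le]
  intro a ha b hb
  have h0 := multiPow_le_eigenspace (symMap (saturatedEven l U hU (t, 1)))
    (c := fun p => (t (Sum.inl p) : ℂ)) (fun p => by
      rintro _ ⟨x, hx, rfl⟩
      rw [Module.End.mem_eigenspace_iff]
      simp [saturatedEven_apply hU t 1 hx]) _ ha
  have h1 := multiPow_le_eigenspace (ExteriorAlgebra.map (saturatedOdd k W hW (t, 1)))
    (c := fun q => (t (Sum.inr q) : ℂ)) (fun p => by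
      rintro _ ⟨x, hx, rfl⟩
      rw [Module.End.mem_eigenspace_iff]
      simp [saturatedOdd_apply hW t 1 hx]) _ hb
  rw [Module.End.mem_eigenspace_iff, AlgHom.toLinearMap_apply] at h0 h1
  rw [Module.End.mem_eigenspace_iff, TensorProduct.mk_apply, superSymRep_tmul, h0, h1,
    TensorProduct.smul_tmul_smul]
  rfl

lemma saturatedRep_apply (t : Fin k ⊕ Fin l → ℂˣ) (g : G) {ij : (Fin k → ℕ) × (Fin l → ℕ)}
    {x : SuperSym V₀ V₁} (hx : x ∈ componentSub U W ij) :
    saturatedRep hU hW (t, g) x = torusChar t ij • superSymRep ρ₀ ρ₁ g x := by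
  have h1 : ((t, g) : Saturated k l G) = (1, g) * (t, 1) := by simp
  rw [h1, map_mul, Module.End.mul_apply,
    Module.End.mem_eigenspace_iff.mp (componentSub_le_eigenspace hU hW t ij hx), map_smul,
    superSymRep_congr (saturatedEven_one hU g) (saturatedOdd_one hW g)]

variable (k l) in
/-- A torus element that separates the components. -/
def primeTorus (s : Fin k ⊕ Fin l) : ℂˣ :=
  Units.mk0 (Nat.nth Nat.Prime (finSumFinEquiv s) : ℂ)
    (Nat.cast_ne_zero.mpr (Nat.prime_nth_prime _).ne_zero)

/-- With distinct primes as coordinates, the character value is a natural number whose prime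
factorization displays all exponents. -/
lemma torusChar_primeTorus_injective :
    Function.Injective (torusChar (primeTorus k l)) := by
  have hcast (ij : (Fin k → ℕ) × (Fin l → ℕ)) : torusChar (primeTorus k l) ij =
      ((∏ s : Fin k ⊕ Fin l, Nat.nth Nat.Prime (finSumFinEquiv s) ^ (Sum.elim ij.1 ij.2 s) : ℕ) :
        ℂ) := by
    rw [Fintype.prod_sum_type]
    simp [torusChar, primeTorus]
  have hfac (ij : (Fin k → ℕ) × (Fin l → ℕ)) (s : Fin k ⊕ Fin l) :
      (∏ s : Fin k ⊕ Fin l, Nat.nth Nat.Prime (finSumFinEquiv s) ^ (Sum.elim ij.1 ij.2 s)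
        ).factorization (Nat.nth Nat.Prime (finSumFinEquiv s)) = Sum.elim ij.1 ij.2 s := by
    rw [Nat.factorization_prod_apply
      (fun s _ => pow_ne_zero _ (Nat.prime_nth_prime _).ne_zero), Finset.sum_eq_single s]
    · simp
    · intro s' _ hs'
      have : Nat.nth Nat.Prime (finSumFinEquiv s') ≠ Nat.nth Nat.Prime (finSumFinEquiv s) := by
        intro h
        exact hs' (finSumFinEquiv.injective
          (Fin.ext (Nat.nth_injective Nat.infinite_setOfPred_prime h)))
      simp [this]
    · simp
  intro ij ij' h
  rw [hcast, hcast, Nat.cast_inj] at h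
  have h2 (s) : Sum.elim ij.1 ij.2 s = Sum.elim ij'.1 ij'.2 s := by rw [← hfac, h, hfac]
  exact Prod.ext (funext fun p => h2 (Sum.inl p)) (funext fun q => h2 (Sum.inr q))

lemma iSup_componentSub (hU : DirectSum.IsInternal fun p => (U p).toSubmodule)
    (hW : DirectSum.IsInternal fun q => (W q).toSubmodule) :
    ⨆ ij, componentSub U W ij = ⊤ :=
  iSup_component hU.submodule_iSup_eq_top hW.submodule_iSup_eq_top

/-- A single torus element with distinct eigenvalues on the components suffices, as eigenspaces are
independent. -/
lemma iSupIndep_componentSub (hU : DirectSum.IsInternal fun p => (U p).toSubmodule)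
    (hW : DirectSum.IsInternal fun q => (W q).toSubmodule) :
    iSupIndep (componentSub U W) :=
  ((Module.End.eigenspaces_iSupIndep (saturatedRep hU hW (primeTorus k l, 1))).comp
    torusChar_primeTorus_injective).mono (componentSub_le_eigenspace hU hW _)

lemma isCompl_componentSub (hU : DirectSum.IsInternal fun p => (U p).toSubmodule)
    (hW : DirectSum.IsInternal fun q => (W q).toSubmodule) (ij : (Fin k → ℕ) × (Fin l → ℕ)) :
    IsCompl (componentSub U W ij) (⨆ (ij') (_ : ij' ≠ ij), componentSub U W ij') := by
  refine ⟨iSupIndep_componentSub hU hW ij, codisjoint_iff.mpr ?_⟩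
  rw [eq_top_iff, ← iSup_componentSub hU hW]
  refine iSup_le fun ij' => ?_
  by_cases h : ij' = ij
  · subst h; exact le_sup_left
  · exact le_sup_of_le_right (le_iSup₂_of_le ij' h le_rfl)

/-- The components span, so an eigenvector is its part in this component plus a remainder. The
remainder has the same eigenvalue but lies in the sum of the other eigenspaces, so it is zero. -/
lemma eigenspace_le_componentSub (ij : (Fin k → ℕ) × (Fin l → ℕ)) :
    Module.End.eigenspace (saturatedRep hU hW (primeTorus k l, 1)) (torusChar (primeTorus k l) ij)
      ≤ componentSub U W ij := by
  intro x hx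
  obtain ⟨y, hy, z, hz, rfl⟩ := Submodule.mem_sup.mp
    ((isCompl_componentSub hU hW ij).sup_eq_top ▸ Submodule.mem_top : x ∈ _)
  have hdis := ((Module.End.eigenspaces_iSupIndep (saturatedRep hU hW (primeTorus k l, 1))).comp
    torusChar_primeTorus_injective) ij
  have hz' : z ∈ Module.End.eigenspace (saturatedRep hU hW (primeTorus k l, 1))
      (torusChar (primeTorus k l) ij) := by
    have := Submodule.sub_mem _ hx (componentSub_le_eigenspace hU hW _ ij hy)
    simpa using this
  have : z = 0 := Submodule.disjoint_def.mp hdis z hz' <|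
    (iSup₂_mono fun ij' _ => componentSub_le_eigenspace hU hW (primeTorus k l) ij') hz
  simpa [this] using hy

/-- Operators that commute with the saturated group preserve the components. -/
lemma map_componentSub_of_commute {D : Module.End ℂ (SuperSym V₀ V₁)}
    (hD : ∀ h, saturatedRep hU hW h * D = D * saturatedRep hU hW h)
    {ij : (Fin k → ℕ) × (Fin l → ℕ)} {x : SuperSym V₀ V₁} (hx : x ∈ componentSub U W ij) :
    D x ∈ componentSub U W ij := by
  apply eigenspace_le_componentSub hU hW ij
  rw [Module.End.mem_eigenspace_iff, ← Module.End.mul_apply, hD, Module.End.mul_apply,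
    Module.End.mem_eigenspace_iff.mp (componentSub_le_eigenspace hU hW _ ij hx), map_smul]

end Saturated

end SuperMF

end

noncomputable section

namespace SuperMF

/-! ### The polarization operator on $A \otimes A$. -/

section Polarization

variable {A V : Type*} [Ring A] [Algebra ℂ A] [AddCommGroup V] [Module ℂ V]

/-- The canonical tensor $\sum_a b_a \otimes b^a$ corresponds to the identity of `V`, and `γ ∘ id ∘
γ'` is again the identity. -/
lemma sum_basis_conj {Z : Type*} [AddCommGroup Z] [Module ℂ Z] (β : V →ₗ[ℂ] Module.Dual ℂ V →ₗ[ℂ] Z)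
    {ι : Type*} [Fintype ι] (b : Module.Basis ι ℂ V) {γ γ' : Module.End ℂ V} (h : γ * γ' = 1) :
    ∑ a, β (γ (b a)) (b.coord a ∘ₗ γ') = ∑ a, β (b a) (b.coord a) := by
  have h1 (a) : β (γ (b a)) (b.coord a ∘ₗ γ') =
      ∑ c, β (b c) (b.coord c (γ (b a)) • (b.coord a ∘ₗ γ')) := by
    have h0 : γ (b a) = ∑ c, b.coord c (γ (b a)) • b c := (b.sum_repr _).symm
    have h2 := congrArg (fun v => β v (b.coord a ∘ₗ γ')) h0
    simpa only [map_sum, map_smul, LinearMap.sum_apply, LinearMap.smul_apply] using h2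
  simp_rw [h1]
  rw [Finset.sum_comm]
  refine Finset.sum_congr rfl fun c _ => ?_
  rw [← map_sum]
  congr 1
  have h2 := b.sum_dual_apply_smul_coord (b.coord c ∘ₗ γ)
  ext v
  have h3 := LinearMap.congr_fun h2 (γ' v)
  have h4 : γ (γ' v) = v := LinearMap.congr_fun h v
  simpa [h4] using h3

variable [FiniteDimensional ℂ V] (x : V →ₗ[ℂ] A) (del : Module.Dual ℂ V →ₗ[ℂ] Module.End ℂ A)

/-- The polarization operator `∑ₐ (· xₐ) ⊗ ∂ₐ` on `A ⊗ A`. -/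
def polarization : Module.End ℂ (A ⊗[ℂ] A) :=
  ∑ a, TensorProduct.map (LinearMap.mulRight ℂ (x (Module.finBasis ℂ V a)))
    (del ((Module.finBasis ℂ V).coord a))

lemma polarization_tmul (u p : A) : polarization x del (u ⊗ₜ p) =
    ∑ a, (u * x (Module.finBasis ℂ V a)) ⊗ₜ del ((Module.finBasis ℂ V).coord a) p := by
  simp [polarization, LinearMap.sum_apply]

lemma map_comp_polarization (F : A →ₐ[ℂ] A) {γ γ' : Module.End ℂ V} (h : γ * γ' = 1)
    (hx : ∀ v, F (x v) = x (γ v)) (hdel : ∀ lam p, F (del lam p) = del (lam ∘ₗ γ') (F p)) :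
    TensorProduct.map F.toLinearMap F.toLinearMap * polarization x del =
      polarization x del * TensorProduct.map F.toLinearMap F.toLinearMap := by
  refine TensorProduct.ext' fun u p => ?_
  simp only [Module.End.mul_apply, polarization_tmul, map_sum, TensorProduct.map_tmul,
    AlgHom.toLinearMap_apply, map_mul, hx, hdel]
  exact sum_basis_conj ((TensorProduct.mk ℂ A A).compl₁₂ (LinearMap.mul ℂ A (F u) ∘ₗ x)
    (LinearMap.flip del (F p))) (Module.finBasis ℂ V) h

/-- Composing with the polarization replaces `T ⊗ D` by a sum of terms `(T ∘ (· xₐ)) ⊗ (D ∂ₐ)`. The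
left factor changes to another linear map and only the right one must stay in `𝒟`, hence the
quantification over all `T`. -/
lemma mul'_map_polarization_mem {𝒟 : Subalgebra ℂ (Module.End ℂ A)} (hdel : ∀ lam, del lam ∈ 𝒟)
    {Z : A →ₗ[ℂ] A ⊗[ℂ] A}
    (hZ : ∀ T, ∀ D ∈ 𝒟, LinearMap.mul' ℂ A ∘ₗ TensorProduct.map T D ∘ₗ Z ∈ 𝒟) :
    ∀ T, ∀ D ∈ 𝒟, LinearMap.mul' ℂ A ∘ₗ TensorProduct.map T D ∘ₗ (polarization x del ∘ₗ Z) ∈ 𝒟 := by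
  intro T D hD
  have h : LinearMap.mul' ℂ A ∘ₗ TensorProduct.map T D ∘ₗ (polarization x del ∘ₗ Z) =
      ∑ a, LinearMap.mul' ℂ A ∘ₗ
        TensorProduct.map (T ∘ₗ LinearMap.mulRight ℂ (x (Module.finBasis ℂ V a)))
          (D * del ((Module.finBasis ℂ V).coord a)) ∘ₗ Z := by
    ext p
    simp only [polarization, LinearMap.comp_apply, LinearMap.sum_apply, map_sum]
    refine Finset.sum_congr rfl fun a _ => ?_
    rw [Module.End.mul_eq_comp, TensorProduct.map_comp]
    rfl
  rw [h]
  exact Subalgebra.sum_mem _ fun a _ => hZ _ _ (𝒟.mul_mem hD (hdel _))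

lemma mul'_map_polarization_pow_mem {𝒟 : Subalgebra ℂ (Module.End ℂ A)} (hdel : ∀ lam, del lam ∈ 𝒟)
    {Z : A →ₗ[ℂ] A ⊗[ℂ] A}
    (hZ : ∀ T, ∀ D ∈ 𝒟, LinearMap.mul' ℂ A ∘ₗ TensorProduct.map T D ∘ₗ Z ∈ 𝒟) (n : ℕ) :
    ∀ T, ∀ D ∈ 𝒟, LinearMap.mul' ℂ A ∘ₗ TensorProduct.map T D ∘ₗ ((polarization x del ^ n) ∘ₗ Z) ∈ 𝒟
    := by
  induction n with
  | zero => rwa [pow_zero, Module.End.one_eq_id, LinearMap.id_comp]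
  | succ n ih =>
    rw [pow_succ', Module.End.mul_eq_comp, LinearMap.comp_assoc]
    exact mul'_map_polarization_mem x del hdel ih

/-- Each polarization lowers the degree of the right factor by one and, by Euler's identity,
multiplies the product of both factors by the degree before lowering; together these degrees give
`n!`. The grading `P` is abstract so that the even and the odd degree can be treated in turn. -/
lemma polarization_pow_mem_and_mul' {P : ℕ → Submodule ℂ A}
    (hlow : ∀ n lam, ∀ p ∈ P (n + 1), del lam p ∈ P n)
    (heuler : ∀ n, ∀ p ∈ P n, ∑ a, x (Module.finBasis ℂ V a) *
      del ((Module.finBasis ℂ V).coord a) p = (n : ℂ) • p) (n : ℕ) :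
    ∀ z ∈ Submodule.map₂ (TensorProduct.mk ℂ A A) ⊤ (P n),
      (polarization x del ^ n) z ∈ Submodule.map₂ (TensorProduct.mk ℂ A A) ⊤ (P 0) ∧
      LinearMap.mul' ℂ A ((polarization x del ^ n) z) =
        (n.factorial : ℂ) • LinearMap.mul' ℂ A z := by
  induction n with
  | zero => intro z hz; simpa using hz
  | succ n ih =>
    intro z hz
    have h1 : polarization x del z ∈ Submodule.map₂ (TensorProduct.mk ℂ A A) ⊤ (P n) := by
      rw [← Submodule.mem_comap]
      refine (Submodule.map₂_le.mpr fun u _ p hp => ?_) hz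
      rw [Submodule.mem_comap, TensorProduct.mk_apply, polarization_tmul]
      exact Submodule.sum_mem _ fun a _ => Submodule.apply_mem_map₂ _ trivial (hlow _ _ _ hp)
    have h2 : LinearMap.mul' ℂ A (polarization x del z) =
        ((n + 1 : ℕ) : ℂ) • LinearMap.mul' ℂ A z := by
      suffices z ∈ LinearMap.eqLocus (LinearMap.mul' ℂ A ∘ₗ polarization x del)
        (((n + 1 : ℕ) : ℂ) • LinearMap.mul' ℂ A) from this
      refine (Submodule.map₂_le.mpr fun u _ p hp => ?_) hz
      rw [LinearMap.mem_eqLocus, TensorProduct.mk_apply, LinearMap.comp_apply, polarization_tmul,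
        map_sum]
      simp only [LinearMap.mul'_apply, LinearMap.smul_apply, mul_assoc]
      rw [← Finset.mul_sum, heuler _ p hp, mul_smul_comm]
    obtain ⟨h3, h4⟩ := ih _ h1
    rw [pow_succ, Module.End.mul_apply]
    refine ⟨h3, ?_⟩
    rw [h4, h2, smul_smul, Nat.factorial_succ, ← Nat.cast_mul, mul_comm]

end Polarization

/-! ### Degree and Euler identities for the symmetric and the exterior algebra. -/

section EvenOdd

variable {V₀ V₁ : Type*} [AddCommGroup V₀] [Module ℂ V₀] [AddCommGroup V₁] [Module ℂ V₁]

lemma symDeriv_mem_pow (lam : Module.Dual ℂ V₀) (m : ℕ) :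
    ∀ p ∈ LinearMap.range (SymmetricAlgebra.ι ℂ V₀) ^ (m + 1),
      symDeriv lam p ∈ LinearMap.range (SymmetricAlgebra.ι ℂ V₀) ^ m := by
  induction m with
  | zero =>
    intro p hp
    rw [zero_add, pow_one] at hp
    obtain ⟨v, rfl⟩ := hp
    rw [symDeriv_ι, pow_zero]
    exact Submodule.algebraMap_mem _
  | succ m ih =>
    intro p hp
    rw [pow_succ] at hp
    induction hp using Submodule.mul_induction_on' with
    | mem_mul_mem a ha b hb =>
      obtain ⟨v, rfl⟩ := hb
      rw [Derivation.leibniz, symDeriv_ι, smul_eq_mul, smul_eq_mul, mul_comm a,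
        ← Algebra.smul_def, mul_comm _ (symDeriv lam a), pow_succ]
      exact Submodule.add_mem _ (Submodule.smul_mem _ _ ha)
        (Submodule.mul_mem_mul (ih a ha) ⟨v, rfl⟩)
    | add a _ b _ ha hb => rw [map_add]; exact Submodule.add_mem _ ha hb

lemma sum_ι_mul_symDeriv [FiniteDimensional ℂ V₀] (m : ℕ) :
    ∀ p ∈ LinearMap.range (SymmetricAlgebra.ι ℂ V₀) ^ m,
      ∑ a, SymmetricAlgebra.ι ℂ V₀ (Module.finBasis ℂ V₀ a) *
        symDeriv ((Module.finBasis ℂ V₀).coord a) p = (m : ℂ) • p := by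
  induction m with
  | zero =>
    intro p hp
    rw [pow_zero] at hp
    obtain ⟨c, rfl⟩ := Submodule.mem_one.mp hp
    simp
  | succ m ih =>
    intro p hp
    rw [pow_succ] at hp
    induction hp using Submodule.mul_induction_on' with
    | mem_mul_mem q hq b hb =>
      obtain ⟨v, rfl⟩ := hb
      have h1 : ∑ a, SymmetricAlgebra.ι ℂ V₀ (Module.finBasis ℂ V₀ a) *
          algebraMap ℂ _ ((Module.finBasis ℂ V₀).coord a v) = SymmetricAlgebra.ι ℂ V₀ v := by
        conv_rhs => rw [← (Module.finBasis ℂ V₀).sum_repr v]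
        rw [map_sum]
        refine Finset.sum_congr rfl fun a _ => ?_
        rw [map_smul, mul_comm, ← Algebra.smul_def]
        rfl
      have h2 (a) : SymmetricAlgebra.ι ℂ V₀ (Module.finBasis ℂ V₀ a) *
          symDeriv ((Module.finBasis ℂ V₀).coord a) (q * SymmetricAlgebra.ι ℂ V₀ v) =
          q * (SymmetricAlgebra.ι ℂ V₀ (Module.finBasis ℂ V₀ a) *
            algebraMap ℂ _ ((Module.finBasis ℂ V₀).coord a v)) +
          (SymmetricAlgebra.ι ℂ V₀ (Module.finBasis ℂ V₀ a) *
            symDeriv ((Module.finBasis ℂ V₀).coord a) q) * SymmetricAlgebra.ι ℂ V₀ v := by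
        rw [Derivation.leibniz, symDeriv_ι, smul_eq_mul, smul_eq_mul]
        ring
      simp_rw [h2]
      rw [Finset.sum_add_distrib, ← Finset.mul_sum, h1, ← Finset.sum_mul, ih q hq]
      rw [Nat.cast_succ, add_smul, one_smul, smul_mul_assoc, add_comm]
    | add a _ b _ ha hb =>
      simp only [map_add, mul_add, Finset.sum_add_distrib, smul_add, ha, hb]

/-- Contraction with a linear form on the exterior algebra. -/
abbrev contract (mu : Module.Dual ℂ V₁) : Module.End ℂ (ExteriorAlgebra ℂ V₁) :=
  CliffordAlgebra.contractLeft (Q := (0 : QuadraticForm ℂ V₁)) mu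

lemma contract_ι_mul (mu : Module.Dual ℂ V₁) (v : V₁) (p : ExteriorAlgebra ℂ V₁) :
    contract mu (ExteriorAlgebra.ι ℂ v * p) = mu v • p - ExteriorAlgebra.ι ℂ v * contract mu p :=
  CliffordAlgebra.contractLeft_ι_mul _ _ _

lemma contract_algebraMap (mu : Module.Dual ℂ V₁) (r : ℂ) :
    contract mu (algebraMap ℂ (ExteriorAlgebra ℂ V₁) r) = 0 :=
  CliffordAlgebra.contractLeft_algebraMap _ mu r

lemma contract_mem_pow (mu : Module.Dual ℂ V₁) (m : ℕ) :
    ∀ p ∈ LinearMap.range (ExteriorAlgebra.ι ℂ : V₁ →ₗ[ℂ] _) ^ (m + 1),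
      contract mu p ∈ LinearMap.range (ExteriorAlgebra.ι ℂ : V₁ →ₗ[ℂ] _) ^ m := by
  induction m with
  | zero =>
    intro p hp
    rw [zero_add, pow_one] at hp
    obtain ⟨v, rfl⟩ := hp
    have : contract mu (ExteriorAlgebra.ι ℂ v) = algebraMap ℂ _ (mu v) :=
      CliffordAlgebra.contractLeft_ι _ mu v
    rw [this, pow_zero]
    exact Submodule.algebraMap_mem _
  | succ m ih =>
    intro p hp
    rw [pow_succ'] at hp
    induction hp using Submodule.mul_induction_on' with
    | mem_mul_mem b hb a ha =>
      obtain ⟨v, rfl⟩ := hb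
      rw [contract_ι_mul]
      refine Submodule.sub_mem _ (Submodule.smul_mem _ _ ha) ?_
      rw [pow_succ']
      exact Submodule.mul_mem_mul ⟨v, rfl⟩ (ih a ha)
    | add a _ b _ ha hb => rw [map_add]; exact Submodule.add_mem _ ha hb

/-- The sign of the superderivation rule is cancelled by the one from moving the basis vector past
`v`, so the odd Euler identity has the same form as the even one. -/
lemma sum_ι_mul_contract [FiniteDimensional ℂ V₁] (m : ℕ) :
    ∀ p ∈ LinearMap.range (ExteriorAlgebra.ι ℂ : V₁ →ₗ[ℂ] _) ^ m,
      ∑ a, ExteriorAlgebra.ι ℂ (Module.finBasis ℂ V₁ a) *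
        contract ((Module.finBasis ℂ V₁).coord a) p = (m : ℂ) • p := by
  induction m with
  | zero =>
    intro p hp
    rw [pow_zero] at hp
    obtain ⟨c, rfl⟩ := Submodule.mem_one.mp hp
    simp
  | succ m ih =>
    intro p hp
    rw [pow_succ'] at hp
    induction hp using Submodule.mul_induction_on' with
    | mem_mul_mem b hb q hq =>
      obtain ⟨v, rfl⟩ := hb
      have h1 : ∑ a, (Module.finBasis ℂ V₁).coord a v • ExteriorAlgebra.ι ℂ (Module.finBasis ℂ V₁ a)
          = ExteriorAlgebra.ι ℂ v := by
        conv_rhs => rw [← (Module.finBasis ℂ V₁).sum_repr v]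
        rw [map_sum]
        exact Finset.sum_congr rfl fun a _ => (map_smul _ _ _).symm
      have h2 (a) : ExteriorAlgebra.ι ℂ (Module.finBasis ℂ V₁ a) *
          contract ((Module.finBasis ℂ V₁).coord a) (ExteriorAlgebra.ι ℂ v * q) =
          ((Module.finBasis ℂ V₁).coord a v • ExteriorAlgebra.ι ℂ (Module.finBasis ℂ V₁ a)) * q +
          ExteriorAlgebra.ι ℂ v * (ExteriorAlgebra.ι ℂ (Module.finBasis ℂ V₁ a) *
            contract ((Module.finBasis ℂ V₁).coord a) q) := by
        rw [contract_ι_mul, mul_sub, ← mul_assoc, ← mul_assoc,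
          eq_neg_of_add_eq_zero_left
            (ExteriorAlgebra.ι_add_mul_swap (R := ℂ) (Module.finBasis ℂ V₁ a) v),
          mul_smul_comm, smul_mul_assoc, neg_mul, sub_neg_eq_add]
      simp_rw [h2]
      rw [Finset.sum_add_distrib, ← Finset.sum_mul, h1, ← Finset.mul_sum, ih q hq]
      rw [Nat.cast_succ, add_smul, one_smul, mul_smul_comm, add_comm]
    | add a _ b _ ha hb =>
      simp only [map_add, mul_add, Finset.sum_add_distrib, smul_add, ha, hb]

end EvenOdd

end SuperMF

end

noncomputable section

namespace SuperMF

/-! ### Derivations and multiplications on $P(V)$. -/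

section DiffOps

variable {V₀ V₁ : Type*} [AddCommGroup V₀] [Module ℂ V₀] [AddCommGroup V₁] [Module ℂ V₁]

lemma symMap_symDeriv {γ γ' : Module.End ℂ V₀} (h : γ' * γ = 1) (lam : Module.Dual ℂ V₀)
    (a : SymmetricAlgebra ℂ V₀) :
    symMap γ (symDeriv lam a) = symDeriv (lam ∘ₗ γ') (symMap γ a) := by
  induction a using SymmetricAlgebra.induction with
  | algebraMap r => simp
  | ι v =>
    have : γ' (γ v) = v := LinearMap.congr_fun h v
    simp [this]
  | mul a b ha hb => simp [Derivation.leibniz, ha, hb]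
  | add a b ha hb => simp [ha, hb]

lemma map_contract {γ γ' : Module.End ℂ V₁} (h : γ' * γ = 1) (mu : Module.Dual ℂ V₁)
    (b : ExteriorAlgebra ℂ V₁) :
    ExteriorAlgebra.map γ (contract mu b) = contract (mu ∘ₗ γ') (ExteriorAlgebra.map γ b) := by
  induction b using CliffordAlgebra.left_induction with
  | algebraMap r =>
    rw [contract_algebraMap, map_zero]
    have : ExteriorAlgebra.map γ (algebraMap ℂ _ r) = algebraMap ℂ _ r :=
      (ExteriorAlgebra.map γ).commutes r
    rw [show (ExteriorAlgebra.map γ) ((algebraMap ℂ (CliffordAlgebra 0)) r) = algebraMap ℂ _ r from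
      this, contract_algebraMap]
  | add a b ha hb => simp only [map_add, ha, hb]
  | ι_mul x v hx =>
    have e : γ' (γ v) = v := LinearMap.congr_fun h v
    change ExteriorAlgebra.map γ (contract mu (ExteriorAlgebra.ι ℂ v * x)) =
      contract (mu ∘ₗ γ') (ExteriorAlgebra.map γ (ExteriorAlgebra.ι ℂ v * x))
    rw [contract_ι_mul, map_sub, map_smul, map_mul, map_mul, ExteriorAlgebra.map_apply_ι,
      contract_ι_mul, hx, LinearMap.comp_apply, e]

variable (V₀ V₁) in
/-- The inclusion of the even part into `P(V)`. -/
def evenIncl : V₀ →ₗ[ℂ] SuperSym V₀ V₁ :=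
  (TensorProduct.mk ℂ _ _).flip 1 ∘ₗ SymmetricAlgebra.ι ℂ V₀

variable (V₀ V₁) in
/-- The inclusion of the odd part into `P(V)`. -/
def oddIncl : V₁ →ₗ[ℂ] SuperSym V₀ V₁ :=
  TensorProduct.mk ℂ _ _ 1 ∘ₗ ExteriorAlgebra.ι ℂ

lemma symDeriv_add (lam lam' : Module.Dual ℂ V₀) :
    symDeriv (lam + lam') = symDeriv lam + symDeriv lam' := by
  ext a
  induction a using SymmetricAlgebra.induction with
  | algebraMap r => simp
  | ι v => simp
  | mul a b ha hb =>
    rw [Derivation.leibniz, Derivation.leibniz, ha, hb]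
  | add a b ha hb => rw [map_add, map_add, ha, hb]

lemma symDeriv_smul (c : ℂ) (lam : Module.Dual ℂ V₀) :
    symDeriv (c • lam) = c • symDeriv lam := by
  ext a
  induction a using SymmetricAlgebra.induction with
  | algebraMap r => simp
  | ι v => simp [Algebra.smul_def]
  | mul a b ha hb =>
    rw [Derivation.leibniz, Derivation.leibniz, ha, hb]
  | add a b ha hb => rw [map_add, map_add, ha, hb]

variable (V₀ V₁) in
/-- The even derivations, as a linear map in the linear form. -/
def evenDerivₗ : Module.Dual ℂ V₀ →ₗ[ℂ] Module.End ℂ (SuperSym V₀ V₁) where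
  toFun := evenDeriv
  map_add' lam lam' := by
    rw [evenDeriv, symDeriv_add]
    exact TensorProduct.map_add_left _ _ _
  map_smul' c lam := by
    rw [evenDeriv, symDeriv_smul]
    exact TensorProduct.map_smul_left _ _ _

variable (V₀ V₁) in
/-- The odd derivations, as a linear map in the linear form. -/
def oddDerivₗ : Module.Dual ℂ V₁ →ₗ[ℂ] Module.End ℂ (SuperSym V₀ V₁) where
  toFun := oddDeriv
  map_add' mu mu' := by
    rw [oddDeriv, map_add]
    exact TensorProduct.map_add_right _ _ _
  map_smul' c mu := by
    rw [oddDeriv, map_smul]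
    exact TensorProduct.map_smul_right _ _ _

lemma evenDerivₗ_tmul (lam : Module.Dual ℂ V₀) (a : SymmetricAlgebra ℂ V₀)
    (b : ExteriorAlgebra ℂ V₁) : evenDerivₗ V₀ V₁ lam (a ⊗ₜ b) = symDeriv lam a ⊗ₜ b := rfl

lemma oddDerivₗ_tmul (mu : Module.Dual ℂ V₁) (a : SymmetricAlgebra ℂ V₀)
    (b : ExteriorAlgebra ℂ V₁) : oddDerivₗ V₀ V₁ mu (a ⊗ₜ b) = a ⊗ₜ contract mu b := rfl

lemma evenDerivₗ_mem_diffOps (lam : Module.Dual ℂ V₀) :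
    evenDerivₗ V₀ V₁ lam ∈ diffOps V₀ V₁ :=
  Algebra.subset_adjoin (Or.inl (Or.inr ⟨lam, rfl⟩))

lemma oddDerivₗ_mem_diffOps (mu : Module.Dual ℂ V₁) :
    oddDerivₗ V₀ V₁ mu ∈ diffOps V₀ V₁ :=
  Algebra.subset_adjoin (Or.inr ⟨mu, rfl⟩)

/-- The elements whose left multiplication is a differential operator form a subalgebra that
contains the even and the odd generators. -/
lemma mulLeft_mem_diffOps (x : SuperSym V₀ V₁) : LinearMap.mulLeft ℂ x ∈ diffOps V₀ V₁ := by
  suffices h : (diffOps V₀ V₁).comap (Algebra.lmul ℂ (SuperSym V₀ V₁)) = ⊤ by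
    have hx : x ∈ (diffOps V₀ V₁).comap (Algebra.lmul ℂ (SuperSym V₀ V₁)) := h ▸ Algebra.mem_top
    exact hx
  set S := (diffOps V₀ V₁).comap (Algebra.lmul ℂ (SuperSym V₀ V₁)) with hS
  have h0 (a : SymmetricAlgebra ℂ V₀) : a ⊗ₜ (1 : ExteriorAlgebra ℂ V₁) ∈ S := by
    have : S.comap (Algebra.TensorProduct.includeLeft :
        SymmetricAlgebra ℂ V₀ →ₐ[ℂ] SuperSym V₀ V₁) = ⊤ := by
      rw [eq_top_iff, ← symmetricAlgebra_adjoin_range_ι, Algebra.adjoin_le_iff]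
      rintro _ ⟨v, rfl⟩
      exact Algebra.subset_adjoin (Or.inl (Or.inl (Or.inl ⟨v, rfl⟩)))
    exact (this ▸ Algebra.mem_top : a ∈ S.comap _)
  have h1 (b : ExteriorAlgebra ℂ V₁) : (1 : SymmetricAlgebra ℂ V₀) ⊗ₜ b ∈ S := by
    have : S.comap (Algebra.TensorProduct.includeRight :
        ExteriorAlgebra ℂ V₁ →ₐ[ℂ] SuperSym V₀ V₁) = ⊤ := by
      rw [eq_top_iff, ← exteriorAlgebra_adjoin_range_ι, Algebra.adjoin_le_iff]
      rintro _ ⟨v, rfl⟩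
      exact Algebra.subset_adjoin (Or.inl (Or.inl (Or.inr ⟨v, rfl⟩)))
    exact (this ▸ Algebra.mem_top : b ∈ S.comap _)
  rw [eq_top_iff]
  rintro x -
  induction x using TensorProduct.induction_on with
  | zero => exact S.zero_mem
  | tmul a b => simpa using S.mul_mem (h0 a) (h1 b)
  | add a b ha hb => exact S.add_mem ha hb

lemma evenDerivₗ_bidegree (m n : ℕ) (lam : Module.Dual ℂ V₀) :
    ∀ p ∈ bidegree V₀ V₁ (m + 1) n, evenDerivₗ V₀ V₁ lam p ∈ bidegree V₀ V₁ m n := by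
  intro p hp
  rw [← Submodule.mem_comap]
  refine (Submodule.map₂_le.mpr fun a ha b hb => ?_) hp
  exact Submodule.apply_mem_map₂ _ (symDeriv_mem_pow lam m a ha) hb

lemma oddDerivₗ_bidegree (m n : ℕ) (mu : Module.Dual ℂ V₁) :
    ∀ p ∈ bidegree V₀ V₁ m (n + 1), oddDerivₗ V₀ V₁ mu p ∈ bidegree V₀ V₁ m n := by
  intro p hp
  rw [← Submodule.mem_comap]
  refine (Submodule.map₂_le.mpr fun a ha b hb => ?_) hp
  exact Submodule.apply_mem_map₂ _ ha (contract_mem_pow mu n b hb)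

lemma even_euler [FiniteDimensional ℂ V₀] (m n : ℕ) : ∀ p ∈ bidegree V₀ V₁ m n,
    ∑ a, evenIncl V₀ V₁ (Module.finBasis ℂ V₀ a) *
      evenDerivₗ V₀ V₁ ((Module.finBasis ℂ V₀).coord a) p = (m : ℂ) • p := by
  intro p hp
  suffices h : p ∈ LinearMap.eqLocus (∑ a, LinearMap.mulLeft ℂ
      (evenIncl V₀ V₁ (Module.finBasis ℂ V₀ a)) *
        evenDerivₗ V₀ V₁ ((Module.finBasis ℂ V₀).coord a)) ((m : ℂ) • LinearMap.id) by
    simpa [LinearMap.mem_eqLocus, LinearMap.sum_apply] using h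
  refine (Submodule.map₂_le.mpr fun a ha b hb => ?_) hp
  rw [LinearMap.mem_eqLocus, LinearMap.sum_apply]
  simp only [TensorProduct.mk_apply, Module.End.mul_apply, evenDerivₗ_tmul,
    LinearMap.mulLeft_apply, evenIncl, LinearMap.comp_apply, LinearMap.flip_apply,
    Algebra.TensorProduct.tmul_mul_tmul, one_mul]
  rw [← TensorProduct.sum_tmul, sum_ι_mul_symDeriv m a ha]
  rfl

lemma odd_euler [FiniteDimensional ℂ V₁] (m n : ℕ) : ∀ p ∈ bidegree V₀ V₁ m n,
    ∑ a, oddIncl V₀ V₁ (Module.finBasis ℂ V₁ a) *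
      oddDerivₗ V₀ V₁ ((Module.finBasis ℂ V₁).coord a) p = (n : ℂ) • p := by
  intro p hp
  suffices h : p ∈ LinearMap.eqLocus (∑ a, LinearMap.mulLeft ℂ
      (oddIncl V₀ V₁ (Module.finBasis ℂ V₁ a)) *
        oddDerivₗ V₀ V₁ ((Module.finBasis ℂ V₁).coord a)) ((n : ℂ) • LinearMap.id) by
    simpa [LinearMap.mem_eqLocus, LinearMap.sum_apply] using h
  refine (Submodule.map₂_le.mpr fun a ha b hb => ?_) hp
  rw [LinearMap.mem_eqLocus, LinearMap.sum_apply]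
  simp only [TensorProduct.mk_apply, Module.End.mul_apply, oddDerivₗ_tmul,
    LinearMap.mulLeft_apply, oddIncl, LinearMap.comp_apply,
    Algebra.TensorProduct.tmul_mul_tmul, one_mul]
  rw [← TensorProduct.tmul_sum, sum_ι_mul_contract n b hb, TensorProduct.tmul_smul]
  rfl

lemma bidegree_zero_zero : bidegree V₀ V₁ 0 0 = 1 := by
  rw [bidegree, pow_zero, pow_zero, Submodule.one_eq_span, Submodule.one_eq_span,
    Submodule.one_eq_span, Submodule.map₂_span_span, Set.image2_singleton]
  rfl

end DiffOps

/-! ### Equivariant operators realized by invariant differential operators. -/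

section Lift

variable {H : Type*} [Group H]
variable {V₀ V₁ : Type*} [AddCommGroup V₀] [Module ℂ V₀] [AddCommGroup V₁] [Module ℂ V₁]

/-- The automorphism of `P(V)` induced by a group element. -/
def superSymAlgHom (ρ₀ : Representation ℂ H V₀) (ρ₁ : Representation ℂ H V₁) (h : H) :
    SuperSym V₀ V₁ →ₐ[ℂ] SuperSym V₀ V₁ :=
  Algebra.TensorProduct.map (symMap (ρ₀ h)) (ExteriorAlgebra.map (ρ₁ h))

variable [FiniteDimensional ℂ V₀] [FiniteDimensional ℂ V₁]

/-- On a homogeneous part of `P(V)`, each linear operator that commutes with a group action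
agrees with an invariant differential operator. -/
theorem exists_mem_invDiffOps_eqOn_bidegree {ρ₀ : Representation ℂ H V₀}
    {ρ₁ : Representation ℂ H V₁} {T : Module.End ℂ (SuperSym V₀ V₁)}
    (hT : ∀ h, superSymRep ρ₀ ρ₁ h * T = T * superSymRep ρ₀ ρ₁ h) (m n : ℕ) :
    ∃ D ∈ invDiffOps ρ₀ ρ₁, ∀ p ∈ bidegree V₀ V₁ m n, D p = T p := by
  set A := SuperSym V₀ V₁
  set Ω₀ := polarization (evenIncl V₀ V₁) (evenDerivₗ V₀ V₁) with hΩ₀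
  set Ω₁ := polarization (oddIncl V₀ V₁) (oddDerivₗ V₀ V₁) with hΩ₁
  -- On bidegree `(m, n)` this is `p ↦ m! n! (p ⊗ 1)`: all variables are moved to the left factor,
  -- the odd ones first.
  set Z : A →ₗ[ℂ] A ⊗[ℂ] A := (Ω₀ ^ m) ∘ₗ ((Ω₁ ^ n) ∘ₗ TensorProduct.mk ℂ A A 1) with hZ
  refine ⟨((m.factorial * n.factorial : ℕ) : ℂ)⁻¹ • (LinearMap.mul' ℂ A ∘ₗ
    TensorProduct.map T (1 : Module.End ℂ A) ∘ₗ Z), ⟨?_, ?_⟩, ?_⟩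
  · refine Subalgebra.smul_mem _ (mul'_map_polarization_pow_mem _ _ evenDerivₗ_mem_diffOps
      (mul'_map_polarization_pow_mem _ _ oddDerivₗ_mem_diffOps ?_ n) m T 1
      (Subalgebra.one_mem _)) _
    -- Without polarizations the operator is `p ↦ T 1 * D p`.
    intro T D hD
    exact (diffOps V₀ V₁).mul_mem (mulLeft_mem_diffOps (T 1)) hD
  · rw [SetLike.mem_coe, Subalgebra.mem_centralizer_iff]
    rintro _ ⟨h, rfl⟩
    set F := superSymAlgHom ρ₀ ρ₁ h with hF
    have hF' : superSymRep ρ₀ ρ₁ h = F.toLinearMap := rfl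
    have e0 : ρ₀ h * ρ₀ h⁻¹ = 1 := by rw [← map_mul, mul_inv_cancel, map_one]
    have e0' : ρ₀ h⁻¹ * ρ₀ h = 1 := by rw [← map_mul, inv_mul_cancel, map_one]
    have e1 : ρ₁ h * ρ₁ h⁻¹ = 1 := by rw [← map_mul, mul_inv_cancel, map_one]
    have e1' : ρ₁ h⁻¹ * ρ₁ h = 1 := by rw [← map_mul, inv_mul_cancel, map_one]
    have c0 : Commute (TensorProduct.map F.toLinearMap F.toLinearMap) Ω₀ := by
      refine map_comp_polarization _ _ F e0 (fun v => ?_) (fun lam p => ?_)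
      · simp [hF, superSymAlgHom, evenIncl]
      · suffices F.toLinearMap ∘ₗ evenDerivₗ V₀ V₁ lam =
          evenDerivₗ V₀ V₁ (lam ∘ₗ ρ₀ h⁻¹) ∘ₗ F.toLinearMap from LinearMap.congr_fun this p
        refine TensorProduct.ext' fun a b => ?_
        simp [hF, superSymAlgHom, evenDerivₗ_tmul, symMap_symDeriv e0']
    have c1 : Commute (TensorProduct.map F.toLinearMap F.toLinearMap) Ω₁ := by
      refine map_comp_polarization _ _ F e1 (fun v => ?_) (fun lam p => ?_)
      · simp [hF, superSymAlgHom, oddIncl]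
      · suffices F.toLinearMap ∘ₗ oddDerivₗ V₀ V₁ lam =
          oddDerivₗ V₀ V₁ (lam ∘ₗ ρ₁ h⁻¹) ∘ₗ F.toLinearMap from LinearMap.congr_fun this p
        refine TensorProduct.ext' fun a b => ?_
        simp [hF, superSymAlgHom, oddDerivₗ_tmul, map_contract e1']
    -- `Z` is equivariant because both polarizations are and the automorphism `F` fixes `1`.
    have cZ (p : A) : TensorProduct.map F.toLinearMap F.toLinearMap (Z p) = Z (F p) := by
      have h0 := LinearMap.congr_fun (c0.pow_right m).eq ((Ω₁ ^ n) (1 ⊗ₜ p))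
      have h1 := LinearMap.congr_fun (c1.pow_right n).eq (1 ⊗ₜ p)
      simp only [Module.End.mul_apply] at h0 h1
      simp only [hZ, LinearMap.comp_apply, TensorProduct.mk_apply]
      rw [h0, h1, TensorProduct.map_tmul]
      simp
    have cT : TensorProduct.map F.toLinearMap F.toLinearMap ∘ₗ TensorProduct.map T 1 =
        TensorProduct.map T 1 ∘ₗ TensorProduct.map F.toLinearMap F.toLinearMap := by
      rw [← TensorProduct.map_comp, ← TensorProduct.map_comp]
      congr 1
      exact hT h
    have cμ : F.toLinearMap ∘ₗ LinearMap.mul' ℂ A =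
        LinearMap.mul' ℂ A ∘ₗ TensorProduct.map F.toLinearMap F.toLinearMap :=
      TensorProduct.ext' fun a b => by simp
    rw [mul_smul_comm, smul_mul_assoc, hF']
    congr 1
    refine LinearMap.ext fun p => ?_
    simp only [Module.End.mul_apply, LinearMap.comp_apply]
    rw [← LinearMap.comp_apply F.toLinearMap, cμ, LinearMap.comp_apply,
      ← LinearMap.comp_apply _ (TensorProduct.map T 1), cT, LinearMap.comp_apply, cZ]
    rfl
  · intro p hp
    -- The odd polarizations lower the right factor from `(m, n)` to `(m, 0)`, after which the even
    -- ones lower it to `(0, 0)`.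
    have h1 := polarization_pow_mem_and_mul' (oddIncl V₀ V₁) (oddDerivₗ V₀ V₁)
      (P := fun n => bidegree V₀ V₁ m n) (fun n => oddDerivₗ_bidegree m n)
      (fun n => odd_euler m n) n ((1 : A) ⊗ₜ p)
      (Submodule.apply_mem_map₂ (TensorProduct.mk ℂ A A) trivial hp)
    have h0 := polarization_pow_mem_and_mul' (evenIncl V₀ V₁) (evenDerivₗ V₀ V₁)
      (P := fun m => bidegree V₀ V₁ m 0) (fun m => evenDerivₗ_bidegree m 0)
      (fun m => even_euler m 0) m _ h1.1
    obtain ⟨h2, h3⟩ := h0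
    rw [h1.2] at h3
    change Z p ∈ _ at h2
    change LinearMap.mul' ℂ A (Z p) = _ at h3
    -- A right factor of bidegree `(0, 0)` is a scalar, so it can be moved into the argument of `T`.
    have h4 (z : A ⊗[ℂ] A)
        (hz : z ∈ Submodule.map₂ (TensorProduct.mk ℂ A A) ⊤ (bidegree V₀ V₁ 0 0)) :
        TensorProduct.map T (1 : Module.End ℂ A) z = T (LinearMap.mul' ℂ A z) ⊗ₜ 1 := by
      rw [bidegree_zero_zero] at hz
      suffices z ∈ LinearMap.eqLocus (TensorProduct.map T (1 : Module.End ℂ A))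
        ((TensorProduct.mk ℂ A A).flip 1 ∘ₗ T ∘ₗ LinearMap.mul' ℂ A) from this
      refine (Submodule.map₂_le.mpr fun u _ c hc => ?_) hz
      obtain ⟨c, rfl⟩ := Submodule.mem_one.mp hc
      simp [LinearMap.mem_eqLocus, Algebra.algebraMap_eq_smul_one]
    simp only [LinearMap.smul_apply, LinearMap.comp_apply]
    rw [h4 _ h2, h3]
    simp only [LinearMap.mul'_apply, mul_one, one_mul, map_smul, smul_smul]
    rw [Nat.cast_mul, inv_mul_cancel₀, one_smul]
    exact mul_ne_zero (Nat.cast_ne_zero.mpr m.factorial_ne_zero)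
      (Nat.cast_ne_zero.mpr n.factorial_ne_zero)

end Lift

end SuperMF

end

noncomputable section

/-! ### Multiplicity-freeness and commutativity of endomorphism algebras. -/

section Semisimple

variable {G X : Type*} [Group G] [AddCommGroup X] [Module ℂ X] {ρ : Representation ℂ G X}

/-- In a semisimple representation the maximal subrepresentations intersect in zero. -/
lemma Representation.IsSemisimpleRepresentation.exists_isCoatom_notMem
    (hρ : ρ.IsSemisimpleRepresentation) {x : X} (hx : x ≠ 0) :
    ∃ N : Subrepresentation ρ, IsCoatom N ∧ x ∉ N.toSubmodule := by
  have := ρ.isSemisimpleRepresentation_iff_isSemisimpleModule_asModule.mp hρ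
  have h := IsSemisimpleModule.jacobson_eq_bot (MonoidAlgebra ℂ G) ρ.asModule
  by_contra! hc
  refine hx ?_
  suffices h1 : (show ρ.asModule from x) ∈ Module.jacobson (MonoidAlgebra ℂ G) ρ.asModule by
    rw [h] at h1
    exact h1
  rw [Module.jacobson, Submodule.mem_sInf]
  intro N hN
  exact hc (Subrepresentation.subrepresentationSubmoduleOrderIso.symm N)
    ((OrderIso.isCoatom_iff _ _).mpr hN)

/-- A surjective linear map whose kernel is a subrepresentation transports the representation
to its target. -/
lemma Subrepresentation.exists_representation_of_ker_eq {Y : Type*} [AddCommGroup Y] [Module ℂ Y]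
    (N : Subrepresentation ρ) (f : X →ₗ[ℂ] Y) (hf : Function.Surjective f)
    (hN : LinearMap.ker f = N.toSubmodule) :
    ∃ (σ : Representation ℂ G Y) (F : ρ.IntertwiningMap σ), F.toLinearMap = f := by
  obtain ⟨s, hs⟩ := f.exists_rightInverse_of_surjective (LinearMap.range_eq_top.mpr hf)
  have hs' (y : Y) : f (s y) = y := LinearMap.congr_fun hs y
  -- The section `s` is only linear; the induced action does not depend on it, because two preimages
  -- differ by an element of the stable kernel.
  have key (g : G) (x : X) : f (ρ g (s (f x))) = f (ρ g x) := by
    rw [← sub_eq_zero, ← map_sub, ← map_sub, ← LinearMap.mem_ker, hN]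
    refine N.apply_mem_toSubmodule g ?_
    rw [← hN, LinearMap.mem_ker, map_sub, hs', sub_self]
  refine ⟨⟨⟨fun g => f ∘ₗ ρ g ∘ₗ s, ?_⟩, fun a b => ?_⟩, ⟨f, fun g => ?_⟩, rfl⟩
  · ext y
    simp [hs']
  · ext y
    simp [key]
  · ext x
    exact (key g x).symm

/-- Subrepresentations of the target pull back to subrepresentations above the maximal `N`, so the
pullback is `N` or everything. -/
lemma Representation.isIrreducible_of_isCoatom {Y : Type*} [AddCommGroup Y] [Module ℂ Y]
    {σ : Representation ℂ G Y} {N : Subrepresentation ρ} (hN : IsCoatom N)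
    (F : ρ.IntertwiningMap σ) (hF : Function.Surjective F)
    (hker : LinearMap.ker F.toLinearMap = N.toSubmodule) : σ.IsIrreducible := by
  have hmem (x : X) : x ∈ N.toSubmodule ↔ F x = 0 := by rw [← hker]; rfl
  let comap (M : Subrepresentation σ) : Subrepresentation ρ :=
    ⟨M.toSubmodule.comap F.toLinearMap, fun g x hx => by
      rw [Submodule.mem_comap, IntertwiningMap.toLinearMap_apply, F.isIntertwining]
      exact M.apply_mem_toSubmodule g hx⟩
  have hle (M : Subrepresentation σ) : N ≤ comap M := fun x (hx : x ∈ N.toSubmodule) => by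
    change F x ∈ M.toSubmodule
    rw [(hmem x).mp hx]
    exact M.toSubmodule.zero_mem
  have : Nontrivial (Subrepresentation σ) := by
    refine ⟨⊥, ⊤, fun h => hN.1 (top_unique fun x _ => (hmem x).mpr ?_)⟩
    have h1 : F x ∈ (⊤ : Subrepresentation σ) := Submodule.mem_top (R := ℂ) (M := Y)
    rw [← h] at h1
    exact (Submodule.mem_bot ℂ).mp h1
  refine ⟨fun M => ?_⟩
  rcases hN.le_iff.mp (hle M) with h | h
  · right
    refine top_unique fun y _ => ?_
    obtain ⟨x, rfl⟩ := hF y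
    have h1 : x ∈ comap M := h ▸ Submodule.mem_top (R := ℂ) (M := X)
    exact h1
  · left
    refine bot_unique fun y hy => ?_
    obtain ⟨x, rfl⟩ := hF y
    have h1 : x ∈ comap M := hy
    rw [h] at h1
    exact (Submodule.mem_bot ℂ).mpr ((hmem x).mp h1)

/-- A semisimple representation with commutative endomorphism algebra is multiplicity-free. -/
lemma Representation.IsSemisimpleRepresentation.rank_intertwiningMap_le_one
    (hρ : ρ.IsSemisimpleRepresentation)
    (hcomm : ∀ S T : ρ.IntertwiningMap ρ, S * T = T * S) {Y : Type*} [AddCommGroup Y] [Module ℂ Y]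
    [FiniteDimensional ℂ Y] (σ : Representation ℂ G Y) (hσ : σ.IsIrreducible) :
    Module.rank ℂ (ρ.IntertwiningMap σ) ≤ 1 := by
  rw [rank_le_one_iff]
  by_cases h0 : ∀ f : ρ.IntertwiningMap σ, f = 0
  · exact ⟨0, fun f => ⟨0, by rw [h0 f, smul_zero]⟩⟩
  push Not at h0
  obtain ⟨f₁, hf₁⟩ := h0
  refine ⟨f₁, fun f₂ => ?_⟩
  have := ρ.isSemisimpleRepresentation_iff_isSemisimpleModule_asModule.mp hρ
  have hsurj := (IsIrreducible.surjective_or_eq_zero f₁).resolve_right hf₁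
  -- Semisimplicity splits the surjection `f₁` equivariantly.
  obtain ⟨s', hs'⟩ := IsSemisimpleModule.lifting_property
    (IntertwiningMap.equivLinearMapAsModule ρ σ f₁) hsurj LinearMap.id
  let s : σ.IntertwiningMap ρ := (IntertwiningMap.equivLinearMapAsModule σ ρ).symm s'
  have hs (y : Y) : f₁ (s y) = y := LinearMap.congr_fun hs' y
  -- By Schur's lemma `f₂ ∘ s` is a scalar `c`, so `f₂ - c f₁` vanishes on the image of `s`.
  obtain ⟨c, hc⟩ :=
    (IsIrreducible.algebraMap_intertwiningMap_bijective_of_isAlgClosed (ρ := σ) (k := ℂ)).2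
      (f₂.comp s)
  have hc' (y : Y) : f₂ (s y) = c • y := congrArg (fun f : σ.IntertwiningMap σ => f y) hc.symm
  refine ⟨c, ?_⟩
  ext x
  -- Commute `s f₁` with `s (f₂ - c f₁)` and apply `f₁`: one order gives `f₂ - c f₁`, the other
  -- gives zero.
  have h1 := congrArg (fun f : ρ.IntertwiningMap ρ => f₁ (f x))
    (hcomm (s.comp f₁) (s.comp (f₂ - c • f₁)))
  simp only [IntertwiningMap.mul_apply, IntertwiningMap.comp_apply, hs] at h1
  have e (z : X) : (f₂ - c • f₁) z = f₂ z - c • f₁ z := rfl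
  rw [e, e, hs, hc', sub_self] at h1
  exact (sub_eq_zero.mp h1).symm

end Semisimple

namespace SuperMF

variable {d : ℕ} {G : Type*} [Group G] [TopologicalSpace G]
  [ChartedSpace (EuclideanSpace ℂ (Fin d)) G]

/-- The endomorphism algebra of a multiplicity-free semisimple representation is commutative. -/
lemma IsHolomorphic.commute_intertwiningMap {X : Type*} [AddCommGroup X] [Module ℂ X]
    [FiniteDimensional ℂ X] {ρ : Representation ℂ G X} (hρ : IsHolomorphic d ρ)
    (hss : ρ.IsSemisimpleRepresentation)
    (hmf : ∀ (Γ : Type) [AddCommGroup Γ] [Module ℂ Γ] [FiniteDimensional ℂ Γ]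
      (σ : Representation ℂ G Γ), IsHolomorphic d σ → σ.IsIrreducible →
      Module.rank ℂ (ρ.IntertwiningMap σ) ≤ 1) (S T : ρ.IntertwiningMap ρ) : S * T = T * S := by
  by_contra hne
  obtain ⟨x, hx⟩ : ∃ x, S (T x) - T (S x) ≠ 0 := by
    by_contra! h
    exact hne (Representation.IntertwiningMap.ext (LinearMap.ext fun x => sub_eq_zero.mp (h x)))
  obtain ⟨N, hN, hxN⟩ := hss.exists_isCoatom_notMem hx
  -- The simple quotient by `N` is modelled on $\mathbb C^n$, since `hmf` speaks only of spaces in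
  -- `Type`.
  set f : X →ₗ[ℂ] (Fin (Module.finrank ℂ (X ⧸ N.toSubmodule)) → ℂ) :=
    (Module.finBasis ℂ (X ⧸ N.toSubmodule)).equivFun.toLinearMap ∘ₗ N.toSubmodule.mkQ with hf
  have hfs : Function.Surjective f :=
    ((Module.finBasis ℂ (X ⧸ N.toSubmodule)).equivFun.surjective).comp (Submodule.mkQ_surjective _)
  have hker : LinearMap.ker f = N.toSubmodule := by
    rw [hf, LinearEquiv.ker_comp, Submodule.ker_mkQ]
  obtain ⟨σ, F, hF⟩ := N.exists_representation_of_ker_eq f hfs hker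
  have hFs : Function.Surjective F := by
    have : (F : X → _) = f := congrArg DFunLike.coe hF
    rwa [this]
  -- If `v` spans the intertwiners, then `v ∘ S` and `v ∘ T` are multiples of `v`. Hence `v`, and
  -- with it the quotient map `F`, kills the commutator, although `x` is not in `N`.
  obtain ⟨v, hv⟩ := rank_le_one_iff.mp (hmf _ σ (hρ.of_surjective F hFs)
    (Representation.isIrreducible_of_isCoatom hN F hFs (hF ▸ hker)))
  obtain ⟨r, hr⟩ := hv F
  obtain ⟨a, ha⟩ := hv (v.comp S)
  obtain ⟨b, hb⟩ := hv (v.comp T)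
  have ha' (z : X) : v (S z) = a • v z :=
    congrArg (fun f : ρ.IntertwiningMap σ => f z) ha.symm
  have hb' (z : X) : v (T z) = b • v z :=
    congrArg (fun f : ρ.IntertwiningMap σ => f z) hb.symm
  refine hxN ?_
  rw [← hker, LinearMap.mem_ker, ← hF, ← hr]
  change r • v _ = 0
  rw [map_sub, ha', hb', hb', ha', smul_comm, sub_self, smul_zero]

end SuperMF

end

noncomputable section

namespace SuperMF

/-! ### Invariant differential operators and endomorphisms of the components. -/

section Components

variable {G : Type*} [Group G] {V₀ V₁ : Type*} [AddCommGroup V₀] [Module ℂ V₀]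
  [AddCommGroup V₁] [Module ℂ V₁]
  {ρ₀ : Representation ℂ G V₀} {ρ₁ : Representation ℂ G V₁} {k l : ℕ}
  {U : Fin k → Subrepresentation ρ₀} {W : Fin l → Subrepresentation ρ₁}
  (hU : DirectSum.IsInternal fun p => (U p).toSubmodule)
  (hW : DirectSum.IsInternal fun q => (W q).toSubmodule)

/-- An invariant differential operator restricts to each component. -/
lemma exists_intertwiningMap_of_mem_invDiffOps {D : Module.End ℂ (SuperSym V₀ V₁)}
    (hD : D ∈ invDiffOps (saturatedEven l U hU) (saturatedOdd k W hW)) (i : Fin k → ℕ)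
    (j : Fin l → ℕ) :
    ∃ T : (componentRep U W i j).toRepresentation.IntertwiningMap
      (componentRep U W i j).toRepresentation, ∀ x, (T x : SuperSym V₀ V₁) = D x := by
  have hD' (h) : saturatedRep hU hW h * D = D * saturatedRep hU hW h :=
    Subalgebra.mem_centralizer_iff ℂ |>.mp hD.2 _ ⟨h, rfl⟩
  have hG (g : G) : superSymRep ρ₀ ρ₁ g * D = D * superSymRep ρ₀ ρ₁ g := by
    rw [← superSymRep_congr (saturatedEven_one hU g) (saturatedOdd_one hW g)]
    exact hD' _
  exact ⟨⟨D.restrict fun x hx => map_componentSub_of_commute hU hW hD' (ij := (i, j)) hx,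
    fun g => LinearMap.ext fun x => Subtype.ext (LinearMap.congr_fun (hG g) x).symm⟩,
    fun x => rfl⟩

/-- Each endomorphism of a component is the restriction of an invariant differential operator. -/
lemma exists_mem_invDiffOps_of_intertwiningMap [FiniteDimensional ℂ V₀] [FiniteDimensional ℂ V₁]
    {i : Fin k → ℕ} {j : Fin l → ℕ}
    (T : (componentRep U W i j).toRepresentation.IntertwiningMap
      (componentRep U W i j).toRepresentation) :
    ∃ D ∈ invDiffOps (saturatedEven l U hU) (saturatedOdd k W hW),
      ∀ x : (componentRep U W i j).toSubmodule, D x = (T x : SuperSym V₀ V₁) := by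
  have hc : IsCompl (componentRep U W i j).toSubmodule
    (⨆ (ij') (_ : ij' ≠ (i, j)), componentSub U W ij') := isCompl_componentSub hU hW (i, j)
  -- Extend `T` by zero on the other components; this commutes with the torus because each component
  -- carries a single character.
  obtain ⟨T', hin, hout⟩ : ∃ T' : Module.End ℂ (SuperSym V₀ V₁),
      (∀ x : (componentRep U W i j).toSubmodule, T' x = (T x : SuperSym V₀ V₁)) ∧
        ∀ ij' ≠ (i, j), ∀ x ∈ componentSub U W ij', T' x = 0 :=
    ⟨LinearMap.ofIsCompl hc ((componentRep U W i j).toSubmodule.subtype ∘ₗ T.toLinearMap) 0,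
      fun x => LinearMap.ofIsCompl_apply_left hc x,
      fun ij' hij x hx => LinearMap.ofIsCompl_apply_right hc ⟨x, le_iSup₂_of_le
        (f := fun ij' (_ : ij' ≠ (i, j)) => componentSub U W ij') ij' hij le_rfl hx⟩⟩
  have hG (ij') (g : G) {x : SuperSym V₀ V₁} (hx : x ∈ componentSub U W ij') :
      superSymRep ρ₀ ρ₁ g x ∈ componentSub U W ij' :=
    (componentRep U W ij'.1 ij'.2).apply_mem_toSubmodule g hx
  have hcomm (h) : saturatedRep hU hW h * T' = T' * saturatedRep hU hW h := by
    obtain ⟨t, g⟩ := h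
    rw [← LinearMap.eqLocus_eq_top, eq_top_iff, ← iSup_componentSub hU hW]
    refine iSup_le fun ij' x hx => ?_
    rw [LinearMap.mem_eqLocus, Module.End.mul_apply, Module.End.mul_apply,
      saturatedRep_apply hU hW t g hx, map_smul]
    by_cases hij : ij' = (i, j)
    · subst hij
      let y : (componentRep U W i j).toSubmodule := ⟨x, hx⟩
      have h1 := saturatedRep_apply hU hW t g (ij := (i, j)) (T y).2
      have h2 := congrArg Subtype.val (Representation.IntertwiningMap.isIntertwining _ _ T g y)
      have h3 : T' x = (T y : SuperSym V₀ V₁) := hin y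
      have h4 := hin ((componentRep U W i j).toRepresentation g y)
      rw [h3, h1]
      exact congrArg (torusChar t (i, j) • ·) (h4.trans h2).symm
    · rw [hout ij' hij x hx, hout ij' hij _ (hG _ g hx), map_zero, smul_zero]
  -- The component lies in one bidegree, and there `D` agrees with the extension; nothing is claimed
  -- about other bidegrees.
  obtain ⟨D, hD, hDT⟩ := exists_mem_invDiffOps_eqOn_bidegree hcomm (∑ p, i p) (∑ q, j q)
  exact ⟨D, hD, fun x => (hDT x (component_le_bidegree _ _ i j x.2)).trans (hin x)⟩

end Components

end SuperMF

end

/-! ### The equivalence. -/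

theorem corollary3p4 {d : ℕ} {G : Type*} [Group G] [TopologicalSpace G]
    [ChartedSpace (EuclideanSpace ℂ (Fin d)) G]
    [LieGroup 𝓘(ℂ, EuclideanSpace ℂ (Fin d)) ω G] [ConnectedSpace G]
    [LieAlgebra.HasTrivialRadical ℂ (GroupLieAlgebra 𝓘(ℂ, EuclideanSpace ℂ (Fin d)) G)]
    {V₀ V₁ : Type*} [AddCommGroup V₀] [Module ℂ V₀] [FiniteDimensional ℂ V₀]
    [AddCommGroup V₁] [Module ℂ V₁] [FiniteDimensional ℂ V₁]
    (ρ₀ : Representation ℂ G V₀) (ρ₁ : Representation ℂ G V₁)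
    (hρ₀ : SuperMF.IsHolomorphic d ρ₀) (hρ₁ : SuperMF.IsHolomorphic d ρ₁)
    {k l : ℕ} (U : Fin k → Subrepresentation ρ₀) (W : Fin l → Subrepresentation ρ₁)
    (hU : DirectSum.IsInternal fun p => (U p).toSubmodule)
    (hW : DirectSum.IsInternal fun q => (W q).toSubmodule)
    (hUirr : ∀ p, (U p).toRepresentation.IsIrreducible)
    (hWirr : ∀ q, (W q).toRepresentation.IsIrreducible) :
    SuperMF.IsSuperMF d U W ↔
      ∀ D₁ ∈ SuperMF.invDiffOps (SuperMF.saturatedEven l U hU) (SuperMF.saturatedOdd k W hW),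
      ∀ D₂ ∈ SuperMF.invDiffOps (SuperMF.saturatedEven l U hU) (SuperMF.saturatedOdd k W hW),
        D₁ * D₂ = D₂ * D₁ := by
  have hfin (i : Fin k → ℕ) (j : Fin l → ℕ) :
      FiniteDimensional ℂ (SuperMF.componentRep U W i j).toSubmodule :=
    Module.Finite.iff_fg.mpr (SuperMF.component_fg _ _ i j)
  have hhol := fun (i : Fin k → ℕ) (j : Fin l → ℕ) =>
    (hρ₀.superSymRep hρ₁).toRepresentation (SuperMF.componentRep U W i j)
  constructor
  · intro hmf D₁ h₁ D₂ h₂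
    -- The components span $P(V)$, so it suffices to compare the two products on each of them.
    rw [← LinearMap.eqLocus_eq_top, eq_top_iff, ← SuperMF.iSup_componentSub hU hW]
    refine iSup_le fun ⟨i, j⟩ x hx => ?_
    obtain ⟨T₁, hT₁⟩ := SuperMF.exists_intertwiningMap_of_mem_invDiffOps hU hW h₁ i j
    obtain ⟨T₂, hT₂⟩ := SuperMF.exists_intertwiningMap_of_mem_invDiffOps hU hW h₂ i j
    have h := congrArg (fun T => ((T ⟨x, hx⟩ : (SuperMF.componentRep U W i j).toSubmodule) :
      SuperMF.SuperSym V₀ V₁)) ((hhol i j).commute_intertwiningMap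
        (hhol i j).isSemisimpleRepresentation (hmf i j) T₁ T₂)
    simp only [Representation.IntertwiningMap.mul_apply, hT₁, hT₂] at h
    exact h
  · intro hcomm i j Γ _ _ _ σ _ hσirr
    refine (hhol i j).isSemisimpleRepresentation.rank_intertwiningMap_le_one (fun S T => ?_) σ hσirr
    -- Two endomorphisms of one component commute because they are restrictions of commuting
    -- operators.
    obtain ⟨D, hD, hDS⟩ := SuperMF.exists_mem_invDiffOps_of_intertwiningMap hU hW S
    obtain ⟨E, hE, hET⟩ := SuperMF.exists_mem_invDiffOps_of_intertwiningMap hU hW T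
    refine Representation.IntertwiningMap.ext (LinearMap.ext fun x => Subtype.ext ?_)
    have h := LinearMap.congr_fun (hcomm D hD E hE) x
    simp only [Module.End.mul_apply, hDS, hET] at h
    exact h
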